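/- Let $D\in\mathbb{R}^{m\times n}$, $\Omega\subseteq\{1,\dots,m\}\times\{1,\dots,n\}$ (the observed entries), $d\in\mathbb{N}$ and $\lambda>0$. Let $\mathcal{P}_\Omega$ set the entries outside $\Omega$ to zero, let $\mathcal{P}_{\Omega^c}$ set those inside $\Omega$ to zero, let $\|\cdot\|_*$ be the nuclear norm, and let $\Phi(S)=\|\mathcal{P}_\Omega(S)\|_{\ell_{1/2}}^{1/2}=\sum_{(i,j)\in\Omega}|S_{ij}|^{1/2}$. Consider the problem $$\min_{U,V,L,S,\widehat U,\widehat V}\ \tfrac{\lambda}{2}\bigl(\|\widehat U\|_*+\|\widehat V\|_*\bigr)+\Phi(S)\quad\text{s.t.}\quad \widehat U=U,\ \widehat V=V,\ UV^T=L,\ L+S=D, \tag{P}$$ with $U,\widehat U\in\mathbb{R}^{m\times d}$, $V,\widehat V\in\mathbb{R}^{n\times d}$, $L,S\in\mathbb{R}^{m\times n}$. Given $\mu_k>0$ and arbitrary initial matrices, the ADMM computes, with $M_k=L_k-\mu_k^{-1}Y_3^k$, $$\begin{aligned} U_{k+1}&=(\widehat U_k+\mu_k^{-1}Y_1^k+M_kV_k)(I_d+V_k^TV_k)^{-1},\\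 V_{k+1}&=(\widehat V_k+\mu_k^{-1}Y_2^k+M_k^TU_{k+1})(I_d+U_{k+1}^TU_{k+1})^{-1},\\ \widehat U_{k+1}&=\mathcal{D}_{\lambda/(2\mu_k)}(U_{k+1}-\mu_k^{-1}Y_1^k),\qquad \widehat V_{k+1}=\mathcal{D}_{\lambda/(2\mu_k)}(V_{k+1}-\mu_k^{-1}Y_2^k),\\ L_{k+1}&=\tfrac12\bigl(U_{k+1}V_{k+1}^T+\mu_k^{-1}Y_3^k-S_k+D-\mu_k^{-1}Y_4^k\bigr),\\ S_{k+1}&=\mathcal{P}_\Omega\bigl(\mathcal{H}_{2/\mu_k}(A_k)\bigr)+\mathcal{P}_{\Omega^c}(A_k),\qquad A_k=D-L_{k+1}-\mu_k^{-1}Y_4^k,\\ Y_1^{k+1}&=Y_1^k+\mu_k(\widehat U_{k+1}-U_{k+1}),\qquad Y_2^{k+1}=Y_2^k+\mu_k(\widehat V_{k+1}-V_{k+1}),\\ Y_3^{k+1}&=Y_3^k+\mu_k(U_{k+1}V_{k+1}^T-L_{k+1}),\qquad Y_4^{k+1}=Y_4^k+\mu_k(L_{k+1}+S_{k+1}-D).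 \end{aligned}$$ Here $\mathcal{D}_\tau$ is singular value thresholding ($P\,\mathrm{diag}(\sigma)\,Q^T\mapsto P\,\mathrm{diag}(\max(\sigma-\tau,0))\,Q^T$ on a singular value decomposition), and $\mathcal{H}_\gamma$ acts entrywise by $\mathcal{H}_\gamma(a)=\frac23a\bigl[1+\cos\frac{2\pi-2\phi_\gamma(a)}{3}\bigr]$ if $|a|>\frac{\sqrt[3]{54\gamma^2}}{4}$ and $\mathcal{H}_\gamma(a)=0$ otherwise, with $\phi_\gamma(a)=\arccos\bigl(\frac{\gamma}{8}(|a|/3)^{-3/2}\bigr)$. Suppose that $\{Y_3^k\}$ is bounded, $\mu_k$ is non-decreasing (for instance $\mu_{k+1}=\rho\mu_k$ with $\rho>1$), and $\sum_{k=0}^\infty \mu_{k+1}/\mu_k^{4/3}<\infty$. Then: (I) $\{(U_k,V_k)\}$, $\{(\widehat U_k,\widehat V_k)\}$, $\{L_k\}$ and $\{S_k\}$ are all Cauchy sequences. (II) Any accumulation point $(U_\star,V_\star,\widehat U_\star,\widehat V_\star,L_\star,S_\star)$ of $\{(U_k,V_k,\widehat U_k,\widehat V_k,L_k,S_k)\}$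 satisfies the following KKT conditions for (P) with some multipliers $Y_1^\star,Y_2^\star,Y_4^\star$: $$\begin{gathered}0\in\tfrac{\lambda}{2}\partial\|\widehat U_\star\|_*+Y_1^\star,\quad 0\in\tfrac{\lambda}{2}\partial\|\widehat V_\star\|_*+Y_2^\star,\quad 0\in\partial\Phi(S_\star)+\mathcal{P}_\Omega(Y_4^\star),\quad \mathcal{P}_{\Omega^c}(Y_4^\star)=0,\\ L_\star=U_\star V_\star^T,\quad \widehat U_\star=U_\star,\quad \widehat V_\star=V_\star,\quad L_\star+S_\star=D,\end{gathered}$$ where $\partial\|\cdot\|_*$ is the convex subdifferential and $\partial\Phi$ the limiting subdifferential. Moreover, $Y_1^\star,Y_2^\star$ can be chosen so that $(U_\star,V_\star,\widehat U_\star,\widehat V_\star,L_\star,S_\star,Y_1^\star,Y_2^\star)$ is an accumulation point of the iterates $(U_k,V_k,\widehat U_k,\widehat V_k,L_k,S_k,Y_1^k,Y_2^k)$; and whenever $(U_\star,V_\star,\widehat U_\star,\widehat V_\star,L_\star,S_\star,Y_1^\star,Y_2^\star,Y_4^\star)$ is an accumulation point of $\{(U_k,V_k,\widehat U_k,\widehat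 V_k,L_k,S_k,Y_1^k,Y_2^k,Y_4^k)\}$, the conditions hold with these multipliers. -/

import Mathlib

open Filter Topology Matrix

namespace HalfRPCA

noncomputable section

/-- The Frobenius inner product of two real matrices. -/
def frobInner {m n : ℕ} (A B : Matrix (Fin m) (Fin n) ℝ) : ℝ :=
  ∑ i, ∑ j, A i j * B i j

/-- The Frobenius norm. -/
def frobNorm {m n : ℕ} (A : Matrix (Fin m) (Fin n) ℝ) : ℝ :=
  Real.sqrt (frobInner A A)

/-- The nuclear norm: the sum of the singular values. -/
def nuclearNorm {m n : ℕ} (A : Matrix (Fin m) (Fin n) ℝ) : ℝ :=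
  (Matrix.toEuclideanLin A).singularValues.sum fun _ s => s

open Classical in
/-- The projection onto the matrices supported on `Ω`. -/
def proj {m n : ℕ} (Ω : Set (Fin m × Fin n)) (A : Matrix (Fin m) (Fin n) ℝ) :
    Matrix (Fin m) (Fin n) ℝ :=
  Matrix.of fun i j => if (i, j) ∈ Ω then A i j else 0

/-- The penalty `Φ(S) = ‖P_Ω(S)‖_{ℓ_{1/2}}^{1/2} = ∑ |P_Ω(S)_{ij}|^{1/2}`. -/
def Phi {m n : ℕ} (Ω : Set (Fin m × Fin n)) (S : Matrix (Fin m) (Fin n) ℝ) : ℝ :=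
  ∑ i, ∑ j, |proj Ω S i j| ^ (1 / 2 : ℝ)

/-! ### Subdifferentials -/

/-- The subdifferential of a convex function on a space of real matrices. -/
def convexSubdiff {m n : ℕ} (f : Matrix (Fin m) (Fin n) ℝ → ℝ) (X : Matrix (Fin m) (Fin n) ℝ) :
    Set (Matrix (Fin m) (Fin n) ℝ) :=
  {G | ∀ Z, f X + frobInner G (Z - X) ≤ f Z}

/-- The Fréchet subdifferential:
`liminf_{Z → X, Z ≠ X} (f Z - f X - ⟨G, Z - X⟩) / ‖Z - X‖ ≥ 0`. -/
def frechetSubdiff {m n : ℕ} (f : Matrix (Fin m) (Fin n) ℝ → ℝ) (X : Matrix (Fin m) (Fin n) ℝ) :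
    Set (Matrix (Fin m) (Fin n) ℝ) :=
  {G | ∀ ε : ℝ, 0 < ε → ∀ᶠ Z in 𝓝 X,
    f X + frobInner G (Z - X) - ε * frobNorm (Z - X) ≤ f Z}

/-- The limiting subdifferential. -/
def limitingSubdiff {m n : ℕ} (f : Matrix (Fin m) (Fin n) ℝ → ℝ) (X : Matrix (Fin m) (Fin n) ℝ) :
    Set (Matrix (Fin m) (Fin n) ℝ) :=
  {G | ∃ (x g : ℕ → Matrix (Fin m) (Fin n) ℝ),
    Tendsto x atTop (𝓝 X) ∧ Tendsto (fun k => f (x k)) atTop (𝓝 (f X)) ∧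
    (∀ k, g k ∈ frechetSubdiff f (x k)) ∧ Tendsto g atTop (𝓝 G)}

/-! ### Thresholding operators -/

/-- `X = D_τ(Y)` for the singular value thresholding operator: `Y = P diag(σ) Qᵀ` is a singular
value decomposition of `Y` and `X = P diag(max(σ - τ, 0)) Qᵀ`. -/
def IsSVT {m n : ℕ} (τ : ℝ) (Y X : Matrix (Fin m) (Fin n) ℝ) : Prop :=
  ∃ (r : ℕ) (P : Matrix (Fin m) (Fin r) ℝ) (Q : Matrix (Fin n) (Fin r) ℝ) (σ : Fin r → ℝ),
    Pᵀ * P = 1 ∧ Qᵀ * Q = 1 ∧ (∀ i, 0 ≤ σ i) ∧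
    Y = P * Matrix.diagonal σ * Qᵀ ∧
    X = P * Matrix.diagonal (fun i => max (σ i - τ) 0) * Qᵀ

open Classical in
/-- The scalar half-thresholding operator `H_γ`. -/
def halfThreshold (γ a : ℝ) : ℝ :=
  if (54 * γ ^ 2) ^ (1 / 3 : ℝ) / 4 < |a| then
    2 / 3 * a * (1 + Real.cos
      ((2 * Real.pi - 2 * Real.arccos (γ / 8 * (|a| / 3) ^ (-(3 / 2) : ℝ))) / 3))
  else 0

/-- The entrywise half-thresholding operator. -/
def halfThresholdMat {m n : ℕ} (γ : ℝ) (A : Matrix (Fin m) (Fin n) ℝ) :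
    Matrix (Fin m) (Fin n) ℝ :=
  A.map (halfThreshold γ)

/-! ### The algorithm -/

/-- The variables and multipliers of the ADMM iteration. -/
structure State (m n d : ℕ) where
  U : Matrix (Fin m) (Fin d) ℝ
  V : Matrix (Fin n) (Fin d) ℝ
  Uhat : Matrix (Fin m) (Fin d) ℝ
  Vhat : Matrix (Fin n) (Fin d) ℝ
  L : Matrix (Fin m) (Fin n) ℝ
  S : Matrix (Fin m) (Fin n) ℝ
  Y₁ : Matrix (Fin m) (Fin d) ℝ
  Y₂ : Matrix (Fin n) (Fin d) ℝ
  Y₃ : Matrix (Fin m) (Fin n) ℝ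
  Y₄ : Matrix (Fin m) (Fin n) ℝ

/-- The tuple `(U, V, Û, V̂, L, S)` of primal variables. -/
def State.primal {m n d : ℕ} (x : State m n d) :
    Matrix (Fin m) (Fin d) ℝ × Matrix (Fin n) (Fin d) ℝ ×
    Matrix (Fin m) (Fin d) ℝ × Matrix (Fin n) (Fin d) ℝ ×
    Matrix (Fin m) (Fin n) ℝ × Matrix (Fin m) (Fin n) ℝ :=
  (x.U, x.V, x.Uhat, x.Vhat, x.L, x.S)

/-- One iteration of the ADMM with penalty parameter `μ`, from the state `x` to the state `x'`
(one pass through the inner loop, then the update of the multipliers). -/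
structure ADMMStep {m n d : ℕ} (Ω : Set (Fin m × Fin n)) (D : Matrix (Fin m) (Fin n) ℝ)
    (lam μ : ℝ) (x x' : State m n d) : Prop where
  U_eq : x'.U = (x.Uhat + μ⁻¹ • x.Y₁ + (x.L - μ⁻¹ • x.Y₃) * x.V) * (1 + x.Vᵀ * x.V)⁻¹
  V_eq : x'.V = (x.Vhat + μ⁻¹ • x.Y₂ + (x.L - μ⁻¹ • x.Y₃)ᵀ * x'.U) * (1 + x'.Uᵀ * x'.U)⁻¹
  Uhat_svt : IsSVT (lam / (2 * μ)) (x'.U - μ⁻¹ • x.Y₁) x'.Uhat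
  Vhat_svt : IsSVT (lam / (2 * μ)) (x'.V - μ⁻¹ • x.Y₂) x'.Vhat
  L_eq : x'.L = (1 / 2 : ℝ) • (x'.U * x'.Vᵀ + μ⁻¹ • x.Y₃ - x.S + D - μ⁻¹ • x.Y₄)
  S_eq : x'.S = proj Ω (halfThresholdMat (2 / μ) (D - x'.L - μ⁻¹ • x.Y₄)) +
    proj Ωᶜ (D - x'.L - μ⁻¹ • x.Y₄)
  Y₁_eq : x'.Y₁ = x.Y₁ + μ • (x'.Uhat - x'.U)
  Y₂_eq : x'.Y₂ = x.Y₂ + μ • (x'.Vhat - x'.V)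
  Y₃_eq : x'.Y₃ = x.Y₃ + μ • (x'.U * x'.Vᵀ - x'.L)
  Y₄_eq : x'.Y₄ = x.Y₄ + μ • (x'.L + x'.S - D)

/-- The KKT conditions of the split problem, for the point `(U, V, Û, V̂, L, S)` and the
multipliers `Y₁`, `Y₂`, `Y₄`. -/
structure IsKKT {m n d : ℕ} (Ω : Set (Fin m × Fin n)) (D : Matrix (Fin m) (Fin n) ℝ) (lam : ℝ)
    (U : Matrix (Fin m) (Fin d) ℝ) (V : Matrix (Fin n) (Fin d) ℝ)
    (Uhat : Matrix (Fin m) (Fin d) ℝ) (Vhat : Matrix (Fin n) (Fin d) ℝ)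
    (L S : Matrix (Fin m) (Fin n) ℝ)
    (Y₁ : Matrix (Fin m) (Fin d) ℝ) (Y₂ : Matrix (Fin n) (Fin d) ℝ)
    (Y₄ : Matrix (Fin m) (Fin n) ℝ) : Prop where
  stat_Uhat : ∃ G ∈ convexSubdiff nuclearNorm Uhat, (lam / 2) • G + Y₁ = 0
  stat_Vhat : ∃ G ∈ convexSubdiff nuclearNorm Vhat, (lam / 2) • G + Y₂ = 0
  stat_S : ∃ G ∈ limitingSubdiff (Phi Ω) S, G + proj Ω Y₄ = 0
  off_support : proj Ωᶜ Y₄ = 0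
  feas_L : L = U * Vᵀ
  feas_Uhat : Uhat = U
  feas_Vhat : Vhat = V
  feas_D : L + S = D

end

end HalfRPCA

/-!
The update of `U` is the ridge least-squares step `(A + M V) (1 + Vᵀ V)⁻¹`. Since `(1 + Vᵀ V)⁻¹`
and `V (1 + Vᵀ V)⁻¹` are contractions, it moves `U` by at most `‖A - U‖ + ‖M - U Vᵀ‖`, whatever
the size of `V`. Both terms are residuals of the constraints, and the multiplier updates express
them as `O(1 / μ k)` once the multipliers are bounded. `Y₃` is bounded by hypothesis; `Y₁` and
`Y₂` are bounded because singular value thresholding makes them `-λ / 2` times a nuclear-norm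
subgradient. The same estimate for `V` has an additional factor `1 + ‖V‖`, from the change of
`U`, which Grönwall's inequality absorbs; as `∑ 1 / μ k` converges, both factors converge.

Half thresholding moves an entry by at most `(2 / μ) ^ (2 / 3)`, so `Y₄ = O(μ ^ (1 / 3))`, which is
enough for `L + S - D` to tend to `0`. Finally, every step satisfies the stationarity inclusions
exactly, and these are closed conditions on the iterates and multipliers.
-/

namespace HalfRPCA

theorem cauchySeq_of_norm_sub_le_mul_one_add_norm {E : Type*} [SeminormedAddCommGroup E]
    {v : ℕ → E} {c : ℕ → ℝ} (hc₀ : ∀ k, 0 ≤ c k) (hc : Summable c)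
    (hv : ∀ k, ‖v (k + 1) - v k‖ ≤ c k * (1 + ‖v k‖)) : CauchySeq v := by
  have hgrowth : ∀ k, 1 + ‖v k‖ ≤ (1 + ‖v 0‖) * Real.exp (∑' i, c i) := fun k => by
    have h := discrete_gronwall (u := fun k => 1 + ‖v k‖) (b := 0) (n₀ := 0) (by positivity)
      (fun k _ => by
        have htri := norm_add_le (v k) (v (k + 1) - v k)
        rw [add_sub_cancel] at htri
        simp only [Pi.zero_apply]
        linarith [hv k])
      (fun k _ => hc₀ k) (fun _ _ => le_rfl) k.zero_le
    simp only [Pi.zero_apply, Finset.sum_const_zero, add_zero] at h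
    exact h.trans (by gcongr; exact hc.sum_le_tsum _ fun i _ => hc₀ i)
  refine cauchySeq_of_dist_le_of_summable
    (fun k => c k * ((1 + ‖v 0‖) * Real.exp (∑' i, c i))) (fun k => ?_) (hc.mul_right _)
  rw [dist_comm, dist_eq_norm]
  exact (hv k).trans (mul_le_mul_of_nonneg_left (hgrowth k) (hc₀ k))

section OperatorNorm

open scoped Matrix.Norms.L2Operator

variable {𝕜 m n d : Type*} [RCLike 𝕜] [Fintype m] [Fintype n] [DecidableEq n]
  [Fintype d] [DecidableEq d]

theorem opNorm_le_bound (A : Matrix m n 𝕜) {C : ℝ} (hC : 0 ≤ C)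
    (h : ∀ v, ‖toEuclideanLin A v‖ ≤ C * ‖v‖) : ‖A‖ ≤ C := by
  rw [l2_opNorm_def]
  exact ContinuousLinearMap.opNorm_le_bound _ hC h

theorem norm_apply_le_opNorm (A : Matrix m n 𝕜) (i : m) (j : n) : ‖A i j‖ ≤ ‖A‖ := by
  have hcol := A.l2_opNorm_mulVec (PiLp.single 2 j (1 : 𝕜))
  have hentry := PiLp.norm_apply_le (toEuclideanLin A (PiLp.single 2 j (1 : 𝕜))) i
  simp only [toLpLin_apply, PiLp.ofLp_single, mulVec_single_one, col_apply,
    PiLp.norm_single, norm_one, mul_one] at hcol hentry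
  exact hentry.trans hcol

theorem opNorm_le_one_of_conjTranspose_mul_self_eq_one {P : Matrix m n 𝕜} (hP : Pᴴ * P = 1) :
    ‖P‖ ≤ 1 := by
  have hone : ‖(1 : Matrix n n 𝕜)‖ ≤ 1 := opNorm_le_bound _ zero_le_one fun v => by simp
  rw [← hP, l2_opNorm_conjTranspose_mul_self] at hone
  exact abs_le_one_iff_mul_self_le_one.2 hone |> (le_abs_self _).trans

theorem opNorm_transpose {m n : Type*} [Fintype m] [DecidableEq m] [Fintype n] [DecidableEq n]
    (A : Matrix m n ℝ) : ‖Aᵀ‖ = ‖A‖ := by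
  rw [← conjTranspose_eq_transpose_of_trivial, l2_opNorm_conjTranspose]

theorem opNorm_mul_mul_le_one {l : Type*} [Fintype l] {A : Matrix l m 𝕜} {B : Matrix m n 𝕜}
    {C : Matrix n d 𝕜} [DecidableEq m] (hA : ‖A‖ ≤ 1) (hB : ‖B‖ ≤ 1) (hC : ‖C‖ ≤ 1) :
    ‖A * B * C‖ ≤ 1 :=
  (l2_opNorm_mul _ C).trans (mul_le_one₀
    ((l2_opNorm_mul A B).trans (mul_le_one₀ hA (norm_nonneg _) hB)) (norm_nonneg _) hC)

omit [DecidableEq n] in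
theorem norm_sq_add_norm_sq_toEuclideanLin (V : Matrix n d 𝕜) (v : EuclideanSpace 𝕜 d) :
    ‖v‖ ^ 2 + ‖toEuclideanLin V v‖ ^ 2 =
      RCLike.re (inner 𝕜 v (toEuclideanLin (1 + Vᴴ * V) v)) := by
  classical
  have hadd : toEuclideanLin (1 + Vᴴ * V) v =
      v + (toEuclideanLin V).adjoint (toEuclideanLin V v) := by
    rw [← toEuclideanLin_conjTranspose_eq_adjoint]
    simp [toLpLin_mul_same, toLpLin_one]
  rw [hadd, inner_add_right, LinearMap.adjoint_inner_right, map_add, inner_self_eq_norm_sq,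
    inner_self_eq_norm_sq]

omit [DecidableEq n] in
open scoped ComplexOrder in
theorem isUnit_det_one_add_conjTranspose_mul_self (V : Matrix n d 𝕜) :
    IsUnit (1 + Vᴴ * V).det :=
  (isUnit_iff_isUnit_det _).1
    (PosDef.one.add_posSemidef (posSemidef_conjTranspose_mul_self V)).isUnit

omit [DecidableEq n] in
theorem opNorm_inv_one_add_conjTranspose_mul_self_le (V : Matrix n d 𝕜) :
    ‖(1 + Vᴴ * V)⁻¹‖ ≤ 1 ∧ ‖V * (1 + Vᴴ * V)⁻¹‖ ≤ 1 := by
  have hdet := isUnit_det_one_add_conjTranspose_mul_self V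
  have hsq : ∀ y : EuclideanSpace 𝕜 d, ‖toEuclideanLin (1 + Vᴴ * V)⁻¹ y‖ ^ 2 +
      ‖toEuclideanLin (V * (1 + Vᴴ * V)⁻¹) y‖ ^ 2 ≤
        ‖toEuclideanLin (1 + Vᴴ * V)⁻¹ y‖ * ‖y‖ := fun y => by
    have h := norm_sq_add_norm_sq_toEuclideanLin V (toEuclideanLin (1 + Vᴴ * V)⁻¹ y)
    simp only [← LinearMap.comp_apply, ← toLpLin_mul_same, mul_nonsing_inv _ hdet, toLpLin_one,
      LinearMap.id_apply] at h
    exact h.trans_le (re_inner_le_norm _ _)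
  constructor <;> refine opNorm_le_bound _ zero_le_one fun y => ?_
  all_goals
    refine abs_le_of_sq_le_sq' ?_ (by positivity) |>.2
    nlinarith [hsq y, sq_nonneg (‖toEuclideanLin (1 + Vᴴ * V)⁻¹ y‖ - ‖y‖),
      sq_nonneg ‖toEuclideanLin (V * (1 + Vᴴ * V)⁻¹) y‖]

theorem opNorm_ridge_sub_le (A U : Matrix m d 𝕜) (M : Matrix m n 𝕜) (V : Matrix n d 𝕜) :
    ‖(A + M * V) * (1 + Vᴴ * V)⁻¹ - U‖ ≤ ‖A - U‖ + ‖M - U * Vᴴ‖ := by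
  have hdet := isUnit_det_one_add_conjTranspose_mul_self V
  have hresidual : (A + M * V) * (1 + Vᴴ * V)⁻¹ - U =
      (A - U) * (1 + Vᴴ * V)⁻¹ + (M - U * Vᴴ) * (V * (1 + Vᴴ * V)⁻¹) := by
    have hU : U = U * (1 + Vᴴ * V) * (1 + Vᴴ * V)⁻¹ :=
      (mul_nonsing_inv_cancel_right _ U hdet).symm
    nth_rw 1 [hU]
    simp only [← Matrix.mul_assoc, ← Matrix.sub_mul, ← Matrix.add_mul]
    congr 1
    simp only [Matrix.mul_add, Matrix.sub_mul, Matrix.mul_one, Matrix.mul_assoc]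
    abel
  obtain ⟨hinv, hmulinv⟩ := opNorm_inv_one_add_conjTranspose_mul_self_le V
  calc ‖(A + M * V) * (1 + Vᴴ * V)⁻¹ - U‖
      ≤ ‖A - U‖ * ‖(1 + Vᴴ * V)⁻¹‖ + ‖M - U * Vᴴ‖ * ‖V * (1 + Vᴴ * V)⁻¹‖ := by
        rw [hresidual]
        exact (norm_add_le _ _).trans (add_le_add (l2_opNorm_mul _ _) (l2_opNorm_mul _ _))
    _ ≤ ‖A - U‖ + ‖M - U * Vᴴ‖ := by
        gcongr <;> exact mul_le_of_le_one_right (norm_nonneg _) ‹_›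

end OperatorNorm

section SingularVectors

variable {𝕜 E F : Type*} [RCLike 𝕜] [NormedAddCommGroup E] [InnerProductSpace 𝕜 E]
  [NormedAddCommGroup F] [InnerProductSpace 𝕜 F]

theorem norm_sq_sum_of_pairwise_inner_eq_zero {ι : Type*} {w : ι → F}
    (hw : Pairwise fun i j => inner 𝕜 (w i) (w j) = 0) (s : Finset ι) :
    ‖∑ i ∈ s, w i‖ ^ 2 = ∑ i ∈ s, ‖w i‖ ^ 2 := by
  classical
  induction s using Finset.induction_on with
  | empty => simp
  | insert i s hi ih =>
    have horth : inner 𝕜 (w i) (∑ j ∈ s, w j) = 0 := by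
      rw [inner_sum]
      exact Finset.sum_eq_zero fun j hj => hw (ne_of_mem_of_not_mem hj hi).symm
    rw [Finset.sum_insert hi, Finset.sum_insert hi, ← ih, sq, sq, sq,
      norm_add_sq_eq_norm_sq_add_norm_sq_of_inner_eq_zero _ _ horth]

theorem norm_constr_le_of_pairwise_inner_eq_zero {ι : Type*} [Fintype ι]
    (b : OrthonormalBasis ι 𝕜 E) {u : ι → F}
    (horth : Pairwise fun i j => inner 𝕜 (u i) (u j) = 0) (hu : ∀ i, ‖u i‖ ≤ 1) (v : E) :
    ‖b.toBasis.constr 𝕜 u v‖ ≤ ‖v‖ := by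
  have hv : b.toBasis.constr 𝕜 u v = ∑ i, b.repr v i • u i := by
    simp [Module.Basis.constr_apply_fintype]
  refine le_of_sq_le_sq ?_ (norm_nonneg v)
  calc ‖b.toBasis.constr 𝕜 u v‖ ^ 2 = ∑ i, ‖b.repr v i • u i‖ ^ 2 := by
        rw [hv, norm_sq_sum_of_pairwise_inner_eq_zero (𝕜 := 𝕜)]
        exact fun i j hij => by
          simp only [inner_smul_left, inner_smul_right, horth hij, mul_zero]
    _ ≤ ∑ i, ‖b.repr v i‖ ^ 2 := by
        gcongr with i
        rw [norm_smul]
        exact mul_le_of_le_one_right (norm_nonneg _) (hu i)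
    _ = ‖v‖ ^ 2 := by rw [← EuclideanSpace.norm_sq_eq, b.repr.norm_map]

theorem exists_orthonormalBasis_norm_eq_singularValues [FiniteDimensional 𝕜 E]
    [FiniteDimensional 𝕜 F] {r : ℕ} (hr : Module.finrank 𝕜 E = r) (T : E →ₗ[𝕜] F) :
    ∃ b : OrthonormalBasis (Fin r) 𝕜 E, (∀ i : Fin r, ‖T (b i)‖ = T.singularValues i) ∧
      Pairwise fun i j => inner 𝕜 (T (b i)) (T (b j)) = 0 := by
  set b := T.isSymmetric_adjoint_comp_self.eigenvectorBasis hr with hb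
  have hinner : ∀ i j, inner 𝕜 (T (b i)) (T (b j)) =
      (T.isSymmetric_adjoint_comp_self.eigenvalues hr j : 𝕜) * inner 𝕜 (b i) (b j) := by
    intro i j
    rw [← LinearMap.adjoint_inner_right, ← LinearMap.comp_apply, hb,
      LinearMap.IsSymmetric.apply_eigenvectorBasis, inner_smul_right]
  refine ⟨b, fun i => ?_, fun i j hij => ?_⟩
  · refine (sq_eq_sq₀ (norm_nonneg _) (T.singularValues_nonneg i)).1 ?_
    rw [T.sq_singularValues_fin hr, ← @inner_self_eq_norm_sq 𝕜, hinner,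
      inner_self_eq_norm_sq_to_K, b.norm_eq_one]
    simp
  · dsimp only
    rw [hinner, b.orthonormal.2 hij, mul_zero]

end SingularVectors

section FrobeniusInner

variable {m n : ℕ} (A B C : Matrix (Fin m) (Fin n) ℝ)

theorem frobInner_eq_trace : frobInner A B = (Aᵀ * B).trace := by
  simp only [frobInner, trace, diag, mul_apply, transpose_apply]
  exact Finset.sum_comm

theorem frobInner_sub_right : frobInner A (B - C) = frobInner A B - frobInner A C := by
  simp only [frobInner_eq_trace, Matrix.mul_sub, trace_sub]

theorem frobInner_eq_sum_inner (b : OrthonormalBasis (Fin n) ℝ (EuclideanSpace ℝ (Fin n))) :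
    frobInner A B = ∑ i, inner ℝ (toEuclideanLin A (b i)) (toEuclideanLin B (b i)) := by
  have htrace : frobInner A B =
      LinearMap.trace ℝ _ ((toEuclideanLin A).adjoint ∘ₗ toEuclideanLin B) := by
    rw [← toEuclideanLin_conjTranspose_eq_adjoint, ← toLpLin_mul_same, toLpLin_eq_toLin,
      Matrix.trace_toLin_eq]
    exact frobInner_eq_trace A B
  simp only [htrace, LinearMap.trace_eq_sum_inner _ b, LinearMap.comp_apply,
    LinearMap.adjoint_inner_right]

open scoped Matrix.Norms.L2Operator

theorem opNorm_le_frobNorm : ‖A‖ ≤ frobNorm A := by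
  refine opNorm_le_bound A (Real.sqrt_nonneg _) fun v => ?_
  refine le_of_sq_le_sq ?_ (mul_nonneg (Real.sqrt_nonneg _) (norm_nonneg v))
  calc ‖toEuclideanLin A v‖ ^ 2 = ∑ i, (∑ j, A i j * v j) ^ 2 := by
        simp [EuclideanSpace.real_norm_sq_eq, toLpLin_apply, mulVec, dotProduct]
    _ ≤ ∑ i, (∑ j, A i j ^ 2) * ∑ j, v j ^ 2 := by
        gcongr with i
        exact Finset.sum_mul_sq_le_sq_mul_sq _ _ _
    _ = (frobNorm A * ‖v‖) ^ 2 := by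
        have hnonneg : 0 ≤ frobInner A A :=
          Finset.sum_nonneg fun _ _ => Finset.sum_nonneg fun _ _ => mul_self_nonneg _
        rw [← Finset.sum_mul, mul_pow, EuclideanSpace.real_norm_sq_eq, frobNorm,
          Real.sq_sqrt hnonneg]
        simp only [frobInner, sq]

theorem abs_apply_le_frobNorm (i : Fin m) (j : Fin n) : |A i j| ≤ frobNorm A :=
  (norm_apply_le_opNorm A i j).trans (opNorm_le_frobNorm A)

end FrobeniusInner

section NuclearNorm

open scoped Matrix.Norms.L2Operator

variable {m n : ℕ} {G A X : Matrix (Fin m) (Fin n) ℝ}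

theorem exists_orthonormalBasis_nuclearNorm_eq_sum (A : Matrix (Fin m) (Fin n) ℝ) :
    ∃ b : OrthonormalBasis (Fin n) ℝ (EuclideanSpace ℝ (Fin n)),
      nuclearNorm A = ∑ i, ‖toEuclideanLin A (b i)‖ ∧
      Pairwise fun i j => inner ℝ (toEuclideanLin A (b i)) (toEuclideanLin A (b j)) = 0 := by
  have hn : Module.finrank ℝ (EuclideanSpace ℝ (Fin n)) = n := finrank_euclideanSpace_fin
  obtain ⟨b, hnorm, horth⟩ := exists_orthonormalBasis_norm_eq_singularValues hn (toEuclideanLin A)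
  have hsupp : (toEuclideanLin A).singularValues.support ⊆ Finset.range n := fun k hk => by
    by_contra hkn
    rw [Finset.mem_range, not_lt, ← hn] at hkn
    exact Finsupp.mem_support_iff.1 hk (LinearMap.singularValues_of_finrank_le _ hkn)
  refine ⟨b, ?_, horth⟩
  rw [nuclearNorm, Finsupp.sum_of_support_subset _ hsupp _ fun _ _ => rfl, Finset.sum_range]
  simp only [hnorm]

theorem frobInner_le_nuclearNorm (hG : ‖G‖ ≤ 1) (A : Matrix (Fin m) (Fin n) ℝ) :
    frobInner G A ≤ nuclearNorm A := by
  obtain ⟨b, hb, -⟩ := exists_orthonormalBasis_nuclearNorm_eq_sum A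
  rw [frobInner_eq_sum_inner G A b, hb]
  gcongr with i
  have hGb : ‖toEuclideanLin G (b i)‖ ≤ 1 := by
    have h := G.l2_opNorm_mulVec (b i)
    rw [b.norm_eq_one, mul_one] at h
    exact h.trans hG
  exact (real_inner_le_norm _ _).trans (mul_le_of_le_one_left (norm_nonneg _) hGb)

theorem exists_opNorm_le_one_frobInner_eq_nuclearNorm (A : Matrix (Fin m) (Fin n) ℝ) :
    ∃ C : Matrix (Fin m) (Fin n) ℝ, ‖C‖ ≤ 1 ∧ frobInner C A = nuclearNorm A := by
  obtain ⟨b, hb, horth⟩ := exists_orthonormalBasis_nuclearNorm_eq_sum A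
  set T := toEuclideanLin A
  let u : Fin n → EuclideanSpace ℝ (Fin m) := fun i => ‖T (b i)‖⁻¹ • T (b i)
  have hu_orth : Pairwise fun i j => inner ℝ (u i) (u j) = 0 := fun i j hij => by
    simp only [u, inner_smul_left, inner_smul_right, horth hij, mul_zero]
  have hu_norm : ∀ i, ‖u i‖ ≤ 1 := fun i => by
    rw [norm_smul, norm_inv, norm_norm]
    exact inv_mul_le_one
  refine ⟨toEuclideanLin.symm (b.toBasis.constr ℝ u), ?_, ?_⟩
  · refine opNorm_le_bound _ zero_le_one fun v => ?_
    rw [LinearEquiv.apply_symm_apply, one_mul]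
    exact norm_constr_le_of_pairwise_inner_eq_zero b hu_orth hu_norm v
  · rw [frobInner_eq_sum_inner _ _ b, hb]
    refine Finset.sum_congr rfl fun i _ => ?_
    have hbi : b.toBasis.constr ℝ u (b i) = u i := by
      simpa only [b.coe_toBasis] using b.toBasis.constr_basis ℝ u i
    rw [LinearEquiv.apply_symm_apply, hbi, real_inner_smul_left, real_inner_self_eq_norm_sq, sq,
      ← mul_assoc, inv_mul_mul_self]

theorem mem_convexSubdiff_nuclearNorm (hG : ‖G‖ ≤ 1) (hGX : nuclearNorm X ≤ frobInner G X) :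
    G ∈ convexSubdiff nuclearNorm X := fun Z => by
  rw [frobInner_sub_right]
  linarith [frobInner_le_nuclearNorm hG Z]

end NuclearNorm

section Closedness

variable {m n : ℕ}

theorem continuous_frobInner {X : Type*} [TopologicalSpace X] {f g : X → Matrix (Fin m) (Fin n) ℝ}
    (hf : Continuous f) (hg : Continuous g) : Continuous fun x => frobInner (f x) (g x) := by
  simp only [frobInner_eq_trace]
  exact (hf.matrix_transpose.matrix_mul hg).matrix_trace

theorem lowerSemicontinuous_nuclearNorm :
    LowerSemicontinuous (nuclearNorm : Matrix (Fin m) (Fin n) ℝ → ℝ) := by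
  open scoped Matrix.Norms.L2Operator in
  have hsup : ∀ y, (nuclearNorm : Matrix (Fin m) (Fin n) ℝ → ℝ) ⁻¹' Set.Iic y =
      ⋂ C ∈ Metric.closedBall 0 1, {A | frobInner C A ≤ y} := fun y => by
    ext A
    simp only [Set.mem_preimage, Set.mem_Iic, Set.mem_iInter, mem_closedBall_zero_iff,
      Set.mem_ofPred_eq]
    refine ⟨fun h C hC => (frobInner_le_nuclearNorm hC A).trans h, fun h => ?_⟩
    obtain ⟨C, hC, hCA⟩ := exists_opNorm_le_one_frobInner_eq_nuclearNorm A
    exact hCA ▸ h C hC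
  refine lowerSemicontinuous_iff_isClosed_preimage.2 fun y => ?_
  rw [hsup]
  exact isClosed_biInter fun C _ =>
    isClosed_le (continuous_frobInner continuous_const continuous_id) continuous_const

theorem isClosed_convexSubdiff_graph {f : Matrix (Fin m) (Fin n) ℝ → ℝ}
    (hf : LowerSemicontinuous f) :
    IsClosed {p : Matrix (Fin m) (Fin n) ℝ × Matrix (Fin m) (Fin n) ℝ |
      p.2 ∈ convexSubdiff f p.1} := by
  have hinter : {p : Matrix (Fin m) (Fin n) ℝ × Matrix (Fin m) (Fin n) ℝ |
      p.2 ∈ convexSubdiff f p.1} =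
        ⋂ Z, (fun p => f p.1 + frobInner p.2 (Z - p.1)) ⁻¹' Set.Iic (f Z) := by
    ext p
    simp [convexSubdiff]
  rw [hinter]
  exact isClosed_iInter fun Z => ((hf.comp continuous_fst).add (continuous_frobInner continuous_snd
    (continuous_const.sub continuous_fst)).lowerSemicontinuous).isClosed_preimage (f Z)

/-- `Y` is a multiplier at `X` for the penalty `c * nuclearNorm`: it satisfies the stationarity
condition `0 ∈ c ∂‖X‖_* + Y`. Both constraints `Û = U` and `V̂ = V` use it, with `c = λ / 2`. -/
def IsNuclearMultiplier (c : ℝ) (X Y : Matrix (Fin m) (Fin n) ℝ) : Prop :=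
  ∃ G ∈ convexSubdiff nuclearNorm X, c • G + Y = 0

theorem isClosed_setOf_isNuclearMultiplier {c : ℝ} (hc : c ≠ 0) :
    IsClosed {p : Matrix (Fin m) (Fin n) ℝ × Matrix (Fin m) (Fin n) ℝ |
      IsNuclearMultiplier c p.1 p.2} := by
  have hsolve : ∀ G Y : Matrix (Fin m) (Fin n) ℝ, c • G + Y = 0 ↔ -(c⁻¹ • Y) = G := fun G Y => by
    rw [← smul_neg, inv_smul_eq_iff₀ hc, neg_eq_iff_add_eq_zero, add_comm]
  simp only [IsNuclearMultiplier, hsolve, exists_eq_right']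
  exact (isClosed_convexSubdiff_graph lowerSemicontinuous_nuclearNorm).preimage
    (continuous_fst.prodMk (continuous_snd.const_smul c⁻¹).neg)

end Closedness

section SingularValueThresholding

open scoped Matrix.Norms.L2Operator

variable {m n r : ℕ} {P : Matrix (Fin m) (Fin r) ℝ} {Q : Matrix (Fin n) (Fin r) ℝ}

theorem frobInner_mul_diagonal_mul_transpose (C : Matrix (Fin m) (Fin n) ℝ)
    (P : Matrix (Fin m) (Fin r) ℝ) (s : Fin r → ℝ) (Q : Matrix (Fin n) (Fin r) ℝ) :
    frobInner C (P * diagonal s * Qᵀ) = ∑ i, (Pᵀ * C * Q) i i * s i := by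
  have hcycle : (Cᵀ * (P * diagonal s * Qᵀ)).trace = ((Pᵀ * C * Q)ᵀ * diagonal s).trace := by
    simp only [transpose_mul, transpose_transpose, ← Matrix.mul_assoc]
    rw [trace_mul_comm, ← Matrix.mul_assoc, ← Matrix.mul_assoc]
  rw [frobInner_eq_trace, hcycle]
  simp only [trace, diag_apply, mul_diagonal, transpose_apply]

theorem nuclearNorm_mul_diagonal_mul_transpose_le {s : Fin r → ℝ} (hP : Pᵀ * P = 1)
    (hQ : Qᵀ * Q = 1) (hs : ∀ i, 0 ≤ s i) :
    nuclearNorm (P * diagonal s * Qᵀ) ≤ ∑ i, s i := by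
  obtain ⟨C, hC, hCX⟩ := exists_opNorm_le_one_frobInner_eq_nuclearNorm (P * diagonal s * Qᵀ)
  have hPCQ : ‖Pᵀ * C * Q‖ ≤ 1 := opNorm_mul_mul_le_one
    ((opNorm_transpose P).trans_le (opNorm_le_one_of_conjTranspose_mul_self_eq_one hP)) hC
    (opNorm_le_one_of_conjTranspose_mul_self_eq_one hQ)
  rw [← hCX, frobInner_mul_diagonal_mul_transpose]
  gcongr with i
  exact mul_le_of_le_one_left (hs i)
    ((le_abs_self _).trans ((norm_apply_le_opNorm _ i i).trans hPCQ))

theorem mul_diagonal_mul_transpose_mem_convexSubdiff {w s : Fin r → ℝ} (hP : Pᵀ * P = 1)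
    (hQ : Qᵀ * Q = 1) (hs : ∀ i, 0 ≤ s i) (hw : ‖w‖ ≤ 1) (hws : ∀ i, w i * s i = s i) :
    ‖P * diagonal w * Qᵀ‖ ≤ 1 ∧
      P * diagonal w * Qᵀ ∈ convexSubdiff nuclearNorm (P * diagonal s * Qᵀ) := by
  have hnorm : ‖P * diagonal w * Qᵀ‖ ≤ 1 := opNorm_mul_mul_le_one
    (opNorm_le_one_of_conjTranspose_mul_self_eq_one hP) ((l2_opNorm_diagonal w).trans_le hw)
    ((opNorm_transpose Q).trans_le (opNorm_le_one_of_conjTranspose_mul_self_eq_one hQ))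
  have hw_eq : Pᵀ * (P * diagonal w * Qᵀ) * Q = diagonal w := by
    simp only [← Matrix.mul_assoc, hP, Matrix.one_mul]
    rw [Matrix.mul_assoc, hQ, Matrix.mul_one]
  refine ⟨hnorm, mem_convexSubdiff_nuclearNorm hnorm ?_⟩
  rw [frobInner_mul_diagonal_mul_transpose, hw_eq]
  simp only [diagonal_apply_eq, hws]
  exact nuclearNorm_mul_diagonal_mul_transpose_le hP hQ hs

theorem IsSVT.exists_mem_convexSubdiff {τ : ℝ} (hτ : 0 < τ) {Y X : Matrix (Fin m) (Fin n) ℝ}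
    (h : IsSVT τ Y X) :
    ∃ G : Matrix (Fin m) (Fin n) ℝ, ‖G‖ ≤ 1 ∧ G ∈ convexSubdiff nuclearNorm X ∧
      Y = X + τ • G := by
  obtain ⟨r, P, Q, σ, hP, hQ, hσ, rfl, rfl⟩ := h
  set s : Fin r → ℝ := fun i => max (σ i - τ) 0
  have hw : ‖fun i => min (σ i / τ) 1‖ ≤ 1 :=
    (pi_norm_le_iff_of_nonneg zero_le_one).2 fun i => by
      rw [Real.norm_of_nonneg (le_min (div_nonneg (hσ i) hτ.le) zero_le_one)]
      exact min_le_right _ _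
  have hws : ∀ i, min (σ i / τ) 1 * s i = s i := fun i => by
    rcases le_total (σ i) τ with h | h
    · simp [s, h]
    · rw [min_eq_right ((one_le_div hτ).2 h), one_mul]
  have hsum : σ = s + τ • fun i => min (σ i / τ) 1 := funext fun i => by
    rcases le_total (σ i) τ with h | h
    · simp [s, h, min_eq_left ((div_le_one hτ).2 h), mul_div_cancel₀ _ hτ.ne']
    · simp [s, h, min_eq_right ((one_le_div hτ).2 h)]
  obtain ⟨hnorm, hmem⟩ := mul_diagonal_mul_transpose_mem_convexSubdiff hP hQ
    (fun i => le_max_right _ _) hw hws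
  refine ⟨_, hnorm, hmem, ?_⟩
  rw [← Matrix.smul_mul, ← Matrix.mul_smul, ← Matrix.add_mul, ← Matrix.mul_add, ← diagonal_smul,
    diagonal_add, ← Pi.add_def, ← hsum]

section MultiplierUpdate

variable {lam μ : ℝ} {U Uhat Y : Matrix (Fin m) (Fin n) ℝ}

theorem IsSVT.exists_multiplier_eq_neg_smul (hlam : 0 < lam) (hμ : 0 < μ)
    (h : IsSVT (lam / (2 * μ)) (U - μ⁻¹ • Y) Uhat) :
    ∃ G : Matrix (Fin m) (Fin n) ℝ, ‖G‖ ≤ 1 ∧ G ∈ convexSubdiff nuclearNorm Uhat ∧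
      Y + μ • (Uhat - U) = -((lam / 2) • G) := by
  obtain ⟨G, hnorm, hmem, hG⟩ := h.exists_mem_convexSubdiff (by positivity)
  refine ⟨G, hnorm, hmem, ?_⟩
  have hμG : μ • U - Y = μ • Uhat + (lam / 2) • G := by
    rw [← smul_inv_smul₀ hμ.ne' Y, ← smul_sub, hG, smul_add, smul_smul]
    congr 2
    field_simp
  calc Y + μ • (Uhat - U) = μ • Uhat - (μ • U - Y) := by module
    _ = -((lam / 2) • G) := by rw [hμG, sub_add_cancel_left]

theorem IsSVT.norm_multiplier_le (hlam : 0 < lam) (hμ : 0 < μ)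
    (h : IsSVT (lam / (2 * μ)) (U - μ⁻¹ • Y) Uhat) : ‖Y + μ • (Uhat - U)‖ ≤ lam / 2 := by
  obtain ⟨G, hnorm, -, hG⟩ := h.exists_multiplier_eq_neg_smul hlam hμ
  rw [hG, norm_neg, norm_smul, Real.norm_of_nonneg (by positivity)]
  exact mul_le_of_le_one_right (by positivity) hnorm

theorem IsSVT.isNuclearMultiplier (hlam : 0 < lam) (hμ : 0 < μ)
    (h : IsSVT (lam / (2 * μ)) (U - μ⁻¹ • Y) Uhat) :
    IsNuclearMultiplier (lam / 2) Uhat (Y + μ • (Uhat - U)) := by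
  obtain ⟨G, -, hmem, hG⟩ := h.exists_multiplier_eq_neg_smul hlam hμ
  exact ⟨G, hmem, by rw [hG, add_neg_cancel]⟩

end MultiplierUpdate

end SingularValueThresholding

section HalfThreshold

variable {γ : ℝ}

theorem halfThreshold_neg (γ a : ℝ) : halfThreshold γ (-a) = -halfThreshold γ a := by
  unfold halfThreshold
  rw [abs_neg]
  split_ifs <;> ring

theorem cutoff_mem_Icc (hγ : 0 ≤ γ) : (54 * γ ^ 2) ^ (1 / 3 : ℝ) / 4 ∈
    Set.Icc (3 / 4 * γ ^ (2 / 3 : ℝ)) (γ ^ (2 / 3 : ℝ)) := by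
  have hsplit : (54 * γ ^ 2) ^ (1 / 3 : ℝ) = 54 ^ (1 / 3 : ℝ) * γ ^ (2 / 3 : ℝ) := by
    rw [Real.mul_rpow (by norm_num) (by positivity), ← Real.rpow_natCast, ← Real.rpow_mul hγ]
    norm_num
  have hcbrt : ∀ x : ℝ, 0 ≤ x → (x ^ 3) ^ (1 / 3 : ℝ) = x := fun x hx => by
    rw [← Real.rpow_natCast, ← Real.rpow_mul hx]
    norm_num
  have hlower : (3 : ℝ) ≤ 54 ^ (1 / 3 : ℝ) := by
    calc (3 : ℝ) = (3 ^ 3) ^ (1 / 3 : ℝ) := (hcbrt 3 (by norm_num)).symm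
      _ ≤ 54 ^ (1 / 3 : ℝ) := by gcongr; norm_num
  have hupper : (54 : ℝ) ^ (1 / 3 : ℝ) ≤ 4 := by
    calc (54 : ℝ) ^ (1 / 3 : ℝ) ≤ (4 ^ 3) ^ (1 / 3 : ℝ) := by gcongr; norm_num
      _ = 4 := hcbrt 4 (by norm_num)
  have hpow : 0 ≤ γ ^ (2 / 3 : ℝ) := by positivity
  rw [hsplit]
  constructor <;> nlinarith

theorem cos_trisection {t : ℝ} (ht₀ : 0 ≤ t) (ht₁ : t ≤ 1) :
    1 / 2 ≤ Real.cos ((Real.pi - Real.arccos t) / 3) ∧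
      3 * Real.cos ((Real.pi - Real.arccos t) / 3) -
        4 * Real.cos ((Real.pi - Real.arccos t) / 3) ^ 3 = t := by
  constructor
  · rw [← Real.cos_pi_div_three]
    apply Real.cos_le_cos_of_nonneg_of_le_pi <;>
      linarith [Real.pi_pos, Real.arccos_nonneg t, Real.arccos_le_pi t]
  · have htriple := Real.cos_three_mul ((Real.pi - Real.arccos t) / 3)
    rw [mul_div_cancel₀ _ (by norm_num : (3 : ℝ) ≠ 0), Real.cos_pi_sub,
      Real.cos_arccos (by linarith) ht₁] at htriple
    linarith

theorem halfThreshold_three_mul_sq {r : ℝ} (hr : 0 < r)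
    (hcut : (54 * γ ^ 2) ^ (1 / 3 : ℝ) / 4 < |3 * r ^ 2|) :
    halfThreshold γ (3 * r ^ 2) =
      (2 * Real.cos ((Real.pi - Real.arccos (γ / 8 * (r ^ 3)⁻¹)) / 3) * r) ^ 2 := by
  have hrpow : (|3 * r ^ 2| / 3) ^ (-(3 / 2) : ℝ) = (r ^ 3)⁻¹ := by
    rw [abs_of_pos (by positivity), mul_div_cancel_left₀ _ (by norm_num : (3 : ℝ) ≠ 0),
      ← Real.rpow_natCast r 2, ← Real.rpow_mul hr.le, ← Real.rpow_natCast r 3,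
      ← Real.rpow_neg hr.le]
    norm_num
  have hdouble : ∀ θ, Real.cos ((2 * Real.pi - 2 * θ) / 3) =
      2 * Real.cos ((Real.pi - θ) / 3) ^ 2 - 1 := fun θ => by
    rw [← Real.cos_two_mul]
    ring_nf
  rw [halfThreshold, if_pos hcut, hrpow, hdouble]
  ring

/- With `a = 3 r²` and `t = γ / (8 r³)`, the trisected angle gives the root `y = 2 q r` of the
stationarity equation `4 y (a - y²) = γ`, where `q = cos ((π - arccos t) / 3)`. -/
theorem exists_halfThreshold_eq_sq (hγ : 0 < γ) {a : ℝ} (ha : 0 < a)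
    (hcut : (54 * γ ^ 2) ^ (1 / 3 : ℝ) / 4 < |a|) :
    ∃ y, γ ^ (1 / 3 : ℝ) / 2 ≤ y ∧ halfThreshold γ a = y ^ 2 ∧ 4 * y * (a - y ^ 2) = γ := by
  obtain ⟨r, hr, rfl⟩ : ∃ r : ℝ, 0 < r ∧ a = 3 * r ^ 2 :=
    ⟨√(a / 3), by positivity, by rw [Real.sq_sqrt (by positivity)]; ring⟩
  have hγr : γ ^ (1 / 3 : ℝ) / 2 ≤ r := by
    have hsq : (γ ^ (1 / 3 : ℝ)) ^ 2 = γ ^ (2 / 3 : ℝ) := by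
      rw [← Real.rpow_natCast, ← Real.rpow_mul hγ.le]
      norm_num
    have hlower := (cutoff_mem_Icc hγ.le).1.trans hcut.le
    rw [abs_of_pos ha, ← hsq] at hlower
    refine le_of_sq_le_sq ?_ hr.le
    linarith
  set t := γ / 8 * (r ^ 3)⁻¹ with ht
  have ht₁ : t ≤ 1 := by
    have hcube : (γ ^ (1 / 3 : ℝ)) ^ 3 = γ := by
      rw [← Real.rpow_natCast, ← Real.rpow_mul hγ.le]
      norm_num
    have hle : (γ ^ (1 / 3 : ℝ) / 2) ^ 3 ≤ r ^ 3 := by gcongr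
    rw [ht, ← div_eq_mul_inv, div_le_one (by positivity)]
    linarith [show (γ ^ (1 / 3 : ℝ) / 2) ^ 3 = γ / 8 by rw [div_pow, hcube]; norm_num]
  obtain ⟨hq, hcubic⟩ := cos_trisection (by positivity) ht₁
  refine ⟨2 * Real.cos ((Real.pi - Real.arccos t) / 3) * r, by nlinarith,
    halfThreshold_three_mul_sq hr hcut, ?_⟩
  have hγt : γ = 8 * r ^ 3 * t := by rw [ht]; field_simp
  rw [hγt]
  linear_combination 8 * r ^ 3 * hcubic

theorem halfThreshold_stationary_and_abs_sub_le (hγ : 0 < γ) (a : ℝ) :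
    2 * (a - halfThreshold γ a) * halfThreshold γ a = γ / 2 * √|halfThreshold γ a| ∧
      |a - halfThreshold γ a| ≤ γ ^ (2 / 3 : ℝ) := by
  by_cases hcut : (54 * γ ^ 2) ^ (1 / 3 : ℝ) / 4 < |a|
  · wlog ha : 0 < a generalizing a
    · have ha₀ : a ≠ 0 := abs_pos.1 (hcut.trans_le' (by positivity))
      have hneg := this (-a) (by rwa [abs_neg]) (by grind)
      rw [halfThreshold_neg, abs_neg, neg_sub_neg, abs_sub_comm] at hneg
      exact ⟨by linarith [hneg.1], hneg.2⟩
    obtain ⟨y, hy, hH, hstat⟩ := exists_halfThreshold_eq_sq hγ ha hcut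
    have hcbrt : 0 < γ ^ (1 / 3 : ℝ) := by positivity
    have hy₀ : 0 < y := by linarith
    have hdiff : 0 < a - y ^ 2 := by
      by_contra! h
      nlinarith
    rw [hH, abs_of_pos hdiff, abs_of_pos (by positivity), Real.sqrt_sq hy₀.le]
    refine ⟨by linear_combination (y / 2) * hstat, ?_⟩
    have hsplit : γ ^ (1 / 3 : ℝ) * γ ^ (2 / 3 : ℝ) = γ := by
      rw [← Real.rpow_add hγ]
      norm_num
    nlinarith
  · have hzero : halfThreshold γ a = 0 := if_neg hcut
    simp only [hzero, sub_zero, mul_zero, abs_zero, Real.sqrt_zero, true_and]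
    exact (not_lt.1 hcut).trans (cutoff_mem_Icc hγ.le).2

end HalfThreshold

section Penalty

variable {m n : ℕ}

theorem mem_frechetSubdiff_sum {φ : Fin m → Fin n → ℝ → ℝ} {G X : Matrix (Fin m) (Fin n) ℝ}
    (h : ∀ i j, ∀ ε > 0, ∀ᶠ z in 𝓝 (X i j),
      φ i j (X i j) + G i j * (z - X i j) - ε * |z - X i j| ≤ φ i j z) :
    G ∈ frechetSubdiff (fun Z => ∑ i, ∑ j, φ i j (Z i j)) X := by
  intro ε hε
  set δ := ε / (m * n + 1) with hδ_def
  have hδ : 0 < δ := by positivity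
  have hδε : m * n * δ ≤ ε := by
    rw [hδ_def, ← mul_div_assoc, div_le_iff₀ (by positivity)]
    linarith
  have hentry : ∀ i j, ∀ᶠ Z : Matrix (Fin m) (Fin n) ℝ in 𝓝 X,
      φ i j (X i j) + G i j * (Z i j - X i j) - δ * |Z i j - X i j| ≤ φ i j (Z i j) := fun i j =>
    ((continuous_id.matrix_elem i j).tendsto X).eventually (h i j δ hδ)
  filter_upwards [eventually_all.2 fun i => eventually_all.2 (hentry i)] with Z hZ
  have herror : ∑ i, ∑ j, δ * |Z i j - X i j| ≤ ε * frobNorm (Z - X) := by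
    calc ∑ i, ∑ j, δ * |Z i j - X i j| ≤ ∑ _i : Fin m, ∑ _j : Fin n, δ * frobNorm (Z - X) := by
          gcongr with i _ j
          exact abs_apply_le_frobNorm (Z - X) i j
      _ = m * n * δ * frobNorm (Z - X) := by
          simp only [Finset.sum_const, Finset.card_univ, Fintype.card_fin, nsmul_eq_mul]
          ring
      _ ≤ ε * frobNorm (Z - X) := mul_le_mul_of_nonneg_right hδε (Real.sqrt_nonneg _)
  have hsum := Finset.sum_le_sum fun i (_ : i ∈ Finset.univ) =>
    Finset.sum_le_sum fun j (_ : j ∈ Finset.univ) => hZ i j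
  simp only [Finset.sum_add_distrib, Finset.sum_sub_distrib] at hsum
  simp only [frobInner, Matrix.sub_apply]
  linarith

theorem hasDerivAt_sqrt_abs {s g : ℝ} (hs : s ≠ 0) (hg : 2 * g * s = √|s|) :
    HasDerivAt (fun z => √|z|) g s := by
  refine ((hasDerivAt_abs hs).sqrt (abs_ne_zero.2 hs)).congr_deriv ?_
  have hsqrt : √|s| ≠ 0 := Real.sqrt_ne_zero'.2 (abs_pos.2 hs)
  have hsq : √|s| * √|s| = SignType.sign s * s := by
    rw [Real.mul_self_sqrt (abs_nonneg s), sign_mul_self]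
  rw [div_eq_iff (mul_ne_zero two_ne_zero hsqrt)]
  refine mul_right_cancel₀ hs ?_
  linear_combination -hsq - √|s| * hg

theorem eventually_le_sqrt_abs {s g ε : ℝ} (hg : 2 * g * s = √|s|) (hε : 0 < ε) :
    ∀ᶠ z in 𝓝 s, √|s| + g * (z - s) - ε * |z - s| ≤ √|z| := by
  rcases eq_or_ne s 0 with rfl | hs
  · have hcont : Continuous fun z : ℝ => |g| * √|z| := by fun_prop
    have hlt : ∀ᶠ z : ℝ in 𝓝 0, |g| * √|z| < 1 :=
      hcont.continuousAt.eventually_lt continuousAt_const (by simp)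
    filter_upwards [hlt] with z hz
    have hlinear : g * z ≤ √|z| :=
      calc g * z ≤ |g| * |z| := (le_abs_self _).trans_eq (abs_mul g z)
        _ = |g| * √|z| * √|z| := by rw [mul_assoc, Real.mul_self_sqrt (abs_nonneg z)]
        _ ≤ √|z| := mul_le_of_le_one_left (Real.sqrt_nonneg _) hz.le
    simp only [abs_zero, Real.sqrt_zero, zero_add, sub_zero]
    linarith [mul_nonneg hε.le (abs_nonneg z)]
  · filter_upwards [(hasDerivAt_sqrt_abs hs hg).isLittleO.def hε] with z hz
    rw [Real.norm_eq_abs, Real.norm_eq_abs, smul_eq_mul] at hz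
    linarith [(abs_le.1 hz).1, mul_comm g (z - s)]

/-- `Y` is a multiplier for the constraint `L + S = D` at `S`: it vanishes off `Ω`, and on `Ω` the
entry `-Y i j` is a subgradient of `|·| ^ (1 / 2)` at `S i j`. The latter is encoded by the
equation `2 * (-Y i j) * S i j = √|S i j|`, which puts no constraint on `Y i j` when `S i j = 0`
and is closed under limits. -/
def IsPenaltyMultiplier (Ω : Set (Fin m × Fin n)) (S Y : Matrix (Fin m) (Fin n) ℝ) : Prop :=
  (∀ i j, (i, j) ∉ Ω → Y i j = 0) ∧ ∀ i j, (i, j) ∈ Ω → 2 * Y i j * S i j = -√|S i j|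

variable {Ω : Set (Fin m × Fin n)} {S Y : Matrix (Fin m) (Fin n) ℝ}

theorem Phi_eq_sum_indicator (Ω : Set (Fin m × Fin n)) :
    Phi Ω = fun S => ∑ i, ∑ j, Ω.indicator (fun _ => √|S i j|) (i, j) := by
  funext S
  refine Finset.sum_congr rfl fun i _ => Finset.sum_congr rfl fun j _ => ?_
  by_cases hij : (i, j) ∈ Ω <;> simp [proj, hij, Real.sqrt_eq_rpow]

theorem IsPenaltyMultiplier.neg_mem_limitingSubdiff (h : IsPenaltyMultiplier Ω S Y) :
    -Y ∈ limitingSubdiff (Phi Ω) S := by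
  have hfrechet : -Y ∈ frechetSubdiff (Phi Ω) S := by
    rw [Phi_eq_sum_indicator]
    refine mem_frechetSubdiff_sum (φ := fun i j s => Ω.indicator (fun _ => √|s|) (i, j))
      fun i j ε hε => ?_
    by_cases hij : (i, j) ∈ Ω
    · simp only [Set.indicator_of_mem hij]
      exact eventually_le_sqrt_abs (by rw [Matrix.neg_apply]; linarith [h.2 i j hij]) hε
    · refine Eventually.of_forall fun z => ?_
      simp only [Set.indicator_of_notMem hij, Matrix.neg_apply, h.1 i j hij]
      linarith [mul_nonneg hε.le (abs_nonneg (z - S i j))]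
  exact ⟨fun _ => S, fun _ => -Y, tendsto_const_nhds, tendsto_const_nhds, fun _ => hfrechet,
    tendsto_const_nhds⟩

theorem IsPenaltyMultiplier.proj_eq (h : IsPenaltyMultiplier Ω S Y) : proj Ω Y = Y := by
  ext i j
  by_cases hij : (i, j) ∈ Ω <;> simp [proj, hij, h.1]

theorem IsPenaltyMultiplier.proj_compl_eq_zero (h : IsPenaltyMultiplier Ω S Y) :
    proj Ωᶜ Y = 0 := by
  ext i j
  by_cases hij : (i, j) ∈ Ω <;> simp [proj, hij, h.1]

theorem exists_isPenaltyMultiplier (Ω : Set (Fin m × Fin n)) (S : Matrix (Fin m) (Fin n) ℝ) :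
    ∃ Y, IsPenaltyMultiplier Ω S Y := by
  classical
  refine ⟨of fun i j => if (i, j) ∈ Ω then -√|S i j| / (2 * S i j) else 0,
    fun i j hij => if_neg hij, fun i j hij => ?_⟩
  rcases eq_or_ne (S i j) 0 with h | h
  · simp [h]
  · simp only [of_apply, if_pos hij]
    field_simp

theorem isClosed_setOf_isPenaltyMultiplier (Ω : Set (Fin m × Fin n)) :
    IsClosed {p : Matrix (Fin m) (Fin n) ℝ × Matrix (Fin m) (Fin n) ℝ |
      IsPenaltyMultiplier Ω p.1 p.2} := by
  have hS : ∀ i j, Continuous fun p : Matrix (Fin m) (Fin n) ℝ × Matrix (Fin m) (Fin n) ℝ =>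
    p.1 i j := fun i j => continuous_fst.matrix_elem i j
  have hY : ∀ i j, Continuous fun p : Matrix (Fin m) (Fin n) ℝ × Matrix (Fin m) (Fin n) ℝ =>
    p.2 i j := fun i j => continuous_snd.matrix_elem i j
  simp only [IsPenaltyMultiplier, Set.ofPred_and, Set.ofPred_forall]
  exact (isClosed_iInter fun i => isClosed_iInter fun j => isClosed_iInter fun _ =>
    isClosed_eq (hY i j) continuous_const).inter
    (isClosed_iInter fun i => isClosed_iInter fun j => isClosed_iInter fun _ =>
      isClosed_eq ((continuous_const.mul (hY i j)).mul (hS i j)) (hS i j).abs.sqrt.neg)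

end Penalty

section PenaltyParameters

variable {μ : ℕ → ℝ}

theorem summable_inv_of_summable_div_rpow (hpos : ∀ k, 0 < μ k) (hmono : Monotone μ)
    (hsum : Summable fun k => μ (k + 1) / μ k ^ (4 / 3 : ℝ)) : Summable fun k => (μ k)⁻¹ := by
  refine (hsum.mul_right (μ 0 ^ (-(2 / 3) : ℝ))).of_nonneg_of_le
    (fun k => (inv_pos.2 (hpos k)).le) fun k => ?_
  have hnum := hpos (k + 1)
  have hden := hpos k
  calc (μ k)⁻¹ = μ k / μ k ^ (4 / 3 : ℝ) * μ k ^ (-(2 / 3) : ℝ) := by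
        nth_rw 2 [← Real.rpow_one (μ k)]
        rw [← Real.rpow_sub hden, ← Real.rpow_add hden, ← Real.rpow_neg_one]
        norm_num
    _ ≤ μ (k + 1) / μ k ^ (4 / 3 : ℝ) * μ 0 ^ (-(2 / 3) : ℝ) :=
        mul_le_mul (div_le_div_of_nonneg_right (hmono k.le_succ) (by positivity))
          (Real.rpow_le_rpow_of_nonpos (hpos 0) (hmono k.zero_le) (by norm_num))
          (by positivity) (by positivity)

theorem tendsto_rpow_one_third_div_self (hpos : ∀ k, 0 < μ k) (hsum : Summable fun k => (μ k)⁻¹) :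
    Tendsto (fun k => μ k ^ (1 / 3 : ℝ) / μ k) atTop (𝓝 0) := by
  have hpow : Tendsto (fun k => (μ k)⁻¹ ^ (2 / 3 : ℝ)) atTop (𝓝 ((0 : ℝ) ^ (2 / 3 : ℝ))) :=
    hsum.tendsto_atTop_zero.rpow_const (Or.inr (by norm_num))
  rw [Real.zero_rpow (by norm_num)] at hpow
  refine hpow.congr fun k => ?_
  nth_rw 3 [← Real.rpow_one (μ k)]
  rw [← Real.rpow_sub (hpos k), Real.inv_rpow (hpos k).le, ← Real.rpow_neg (hpos k).le]
  norm_num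

theorem tendsto_rpow_one_third_div_succ (hpos : ∀ k, 0 < μ k) (hmono : Monotone μ)
    (hsum : Summable fun k => (μ k)⁻¹) :
    Tendsto (fun k => μ k ^ (1 / 3 : ℝ) / μ (k + 1)) atTop (𝓝 0) :=
  squeeze_zero (fun k => div_nonneg (Real.rpow_nonneg (hpos k).le _) (hpos (k + 1)).le)
    (fun k => div_le_div_of_nonneg_left (Real.rpow_nonneg (hpos k).le _) (hpos k)
      (hmono k.le_succ))
    (tendsto_rpow_one_third_div_self hpos hsum)

end PenaltyParameters

section MultiplierUpdates

variable {E : Type*} [SeminormedAddCommGroup E] [NormedSpace ℝ E]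

theorem residual_eq_inv_smul_sub {Y Y' R : E} {μ : ℝ} (hμ : μ ≠ 0) (hY : Y' = Y + μ • R) :
    R = μ⁻¹ • (Y' - Y) := by
  rw [hY, add_sub_cancel_left, inv_smul_smul₀ hμ]

theorem norm_residual_add_inv_smul_le {Y Y' R : E} {μ μ' C : ℝ} (hμ : 0 < μ) (hμ' : 0 < μ')
    (hY : Y' = Y + μ • R) (hC : ‖Y‖ ≤ C) (hC' : ‖Y'‖ ≤ C) :
    ‖R + μ'⁻¹ • Y'‖ ≤ 2 * C * (μ⁻¹ + μ'⁻¹) := by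
  have hμi := inv_pos.2 hμ
  have hμi' := inv_pos.2 hμ'
  have hC₀ := (norm_nonneg Y).trans hC
  calc ‖R + μ'⁻¹ • Y'‖ = ‖μ⁻¹ • (Y' - Y) + μ'⁻¹ • Y'‖ := by
        rw [← residual_eq_inv_smul_sub hμ.ne' hY]
    _ ≤ μ⁻¹ * (C + C) + μ'⁻¹ * C := by
        refine (norm_add_le _ _).trans ?_
        rw [norm_smul_of_nonneg hμi.le, norm_smul_of_nonneg hμi'.le]
        gcongr
        exact (norm_sub_le _ _).trans (add_le_add hC' hC)
    _ ≤ 2 * C * (μ⁻¹ + μ'⁻¹) := by linarith [mul_nonneg hμi'.le hC₀]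

theorem tendsto_residual_zero {Y R : ℕ → E} {μ b : ℕ → ℝ} (hμ : ∀ k, 0 < μ k)
    (hY : ∀ k, Y (k + 1) = Y k + μ k • R (k + 1)) (hb : ∀ k, ‖Y (k + 1)‖ ≤ b k)
    (hself : Tendsto (fun k => b k / μ k) atTop (𝓝 0))
    (hsucc : Tendsto (fun k => b k / μ (k + 1)) atTop (𝓝 0)) : Tendsto R atTop (𝓝 0) := by
  refine (tendsto_add_atTop_iff_nat 2).1 (squeeze_zero_norm (fun k => ?_)
    (by simpa using ((tendsto_add_atTop_iff_nat 1).2 hself).add hsucc))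
  have hμk := inv_pos.2 (hμ (k + 1))
  rw [residual_eq_inv_smul_sub (hμ (k + 1)).ne' (hY (k + 1)), norm_smul_of_nonneg hμk.le,
    ← add_div, div_eq_inv_mul]
  gcongr
  exact (norm_sub_le _ _).trans (add_le_add (hb (k + 1)) (hb k))

end MultiplierUpdates

section Step

open scoped Matrix.Norms.L2Operator

variable {m n d : ℕ} {Ω : Set (Fin m × Fin n)} {D : Matrix (Fin m) (Fin n) ℝ} {lam μ μ' C : ℝ}
  {x x' x'' : State m n d}

theorem ADMMStep.norm_Y₁_le (h : ADMMStep Ω D lam μ x x') (hlam : 0 < lam) (hμ : 0 < μ) :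
    ‖x'.Y₁‖ ≤ lam / 2 :=
  h.Y₁_eq ▸ h.Uhat_svt.norm_multiplier_le hlam hμ

theorem ADMMStep.isNuclearMultiplier_Y₁ (h : ADMMStep Ω D lam μ x x') (hlam : 0 < lam)
    (hμ : 0 < μ) : IsNuclearMultiplier (lam / 2) x'.Uhat x'.Y₁ :=
  h.Y₁_eq ▸ h.Uhat_svt.isNuclearMultiplier hlam hμ

theorem ADMMStep.norm_Y₂_le (h : ADMMStep Ω D lam μ x x') (hlam : 0 < lam) (hμ : 0 < μ) :
    ‖x'.Y₂‖ ≤ lam / 2 :=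
  h.Y₂_eq ▸ h.Vhat_svt.norm_multiplier_le hlam hμ

theorem ADMMStep.isNuclearMultiplier_Y₂ (h : ADMMStep Ω D lam μ x x') (hlam : 0 < lam)
    (hμ : 0 < μ) : IsNuclearMultiplier (lam / 2) x'.Vhat x'.Y₂ :=
  h.Y₂_eq ▸ h.Vhat_svt.isNuclearMultiplier hlam hμ

theorem ADMMStep.Y₄_eq_smul_S_sub (h : ADMMStep Ω D lam μ x x') (hμ : μ ≠ 0) :
    x'.Y₄ = μ • (x'.S - (D - x'.L - μ⁻¹ • x.Y₄)) := by
  calc x'.Y₄ = x.Y₄ + μ • (x'.L + x'.S - D) := h.Y₄_eq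
    _ = μ • (x'.L + x'.S - D) + μ • μ⁻¹ • x.Y₄ := by rw [smul_inv_smul₀ hμ, add_comm]
    _ = μ • (x'.S - (D - x'.L - μ⁻¹ • x.Y₄)) := by module

theorem ADMMStep.S_apply_of_mem (h : ADMMStep Ω D lam μ x x') {i : Fin m} {j : Fin n}
    (hij : (i, j) ∈ Ω) :
    x'.S i j = halfThreshold (2 / μ) ((D - x'.L - μ⁻¹ • x.Y₄) i j) := by
  simp [h.S_eq, proj, hij, halfThresholdMat]

theorem ADMMStep.S_apply_of_notMem (h : ADMMStep Ω D lam μ x x') {i : Fin m} {j : Fin n}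
    (hij : (i, j) ∉ Ω) : x'.S i j = (D - x'.L - μ⁻¹ • x.Y₄) i j := by
  simp [h.S_eq, proj, hij]

theorem ADMMStep.isPenaltyMultiplier_Y₄ (h : ADMMStep Ω D lam μ x x') (hμ : 0 < μ) :
    IsPenaltyMultiplier Ω x'.S x'.Y₄ := by
  refine ⟨fun i j hij => ?_, fun i j hij => ?_⟩ <;>
    rw [h.Y₄_eq_smul_S_sub hμ.ne', Matrix.smul_apply, Matrix.sub_apply]
  · rw [h.S_apply_of_notMem hij, sub_self, smul_zero]
  · have hstat := (halfThreshold_stationary_and_abs_sub_le (γ := 2 / μ) (by positivity)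
      ((D - x'.L - μ⁻¹ • x.Y₄) i j)).1
    rw [← h.S_apply_of_mem hij] at hstat
    rw [smul_eq_mul]
    generalize (D - x'.L - μ⁻¹ • x.Y₄) i j = a at hstat ⊢
    field_simp at hstat
    linarith

theorem mul_two_div_rpow_two_thirds_le (hμ : 0 < μ) :
    μ * (2 / μ) ^ (2 / 3 : ℝ) ≤ 2 * μ ^ (1 / 3 : ℝ) := by
  have htwo : (2 : ℝ) ^ (2 / 3 : ℝ) ≤ 2 :=
    Real.rpow_le_self_of_one_le (by norm_num) (by norm_num)
  calc μ * (2 / μ) ^ (2 / 3 : ℝ) = 2 ^ (2 / 3 : ℝ) * (μ / μ ^ (2 / 3 : ℝ)) := by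
        rw [Real.div_rpow zero_le_two hμ.le]
        ring
    _ = 2 ^ (2 / 3 : ℝ) * μ ^ (1 / 3 : ℝ) := by
        nth_rw 1 [← Real.rpow_one μ]
        rw [← Real.rpow_sub hμ]
        norm_num
    _ ≤ 2 * μ ^ (1 / 3 : ℝ) := by gcongr

theorem ADMMStep.abs_Y₄_apply_le (h : ADMMStep Ω D lam μ x x') (hμ : 0 < μ) (i : Fin m)
    (j : Fin n) : |x'.Y₄ i j| ≤ 2 * μ ^ (1 / 3 : ℝ) := by
  by_cases hij : (i, j) ∈ Ω
  · have hdist := (halfThreshold_stationary_and_abs_sub_le (γ := 2 / μ) (by positivity)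
      ((D - x'.L - μ⁻¹ • x.Y₄) i j)).2
    rw [← h.S_apply_of_mem hij, abs_sub_comm] at hdist
    rw [h.Y₄_eq_smul_S_sub hμ.ne', Matrix.smul_apply, Matrix.sub_apply, smul_eq_mul, abs_mul,
      abs_of_pos hμ]
    exact (mul_le_mul_of_nonneg_left hdist hμ.le).trans (mul_two_div_rpow_two_thirds_le hμ)
  · rw [(h.isPenaltyMultiplier_Y₄ hμ).1 i j hij, abs_zero]
    positivity

/-- The multipliers of the factor constraints `Û = U`, `V̂ = V`, `U Vᵀ = L` are bounded by `C` in
operator norm; this is what controls the next change of the factors. -/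
structure State.MultipliersLE (x : State m n d) (C : ℝ) : Prop where
  norm_Y₁_le : ‖x.Y₁‖ ≤ C
  norm_Y₂_le : ‖x.Y₂‖ ≤ C
  norm_Y₃_le : ‖x.Y₃‖ ≤ C

theorem ADMMStep.norm_sub_U_le (h : ADMMStep Ω D lam μ x x') (h' : ADMMStep Ω D lam μ' x' x'')
    (hμ : 0 < μ) (hμ' : 0 < μ') (hx : x.MultipliersLE C) (hx' : x'.MultipliersLE C) :
    ‖x''.U - x'.U‖ ≤ 4 * C * (μ⁻¹ + μ'⁻¹) := by
  have hridge : ‖x''.U - x'.U‖ ≤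
      ‖x'.Uhat + μ'⁻¹ • x'.Y₁ - x'.U‖ + ‖x'.L - μ'⁻¹ • x'.Y₃ - x'.U * x'.Vᵀ‖ :=
    h'.U_eq ▸ opNorm_ridge_sub_le _ x'.U _ x'.V
  have hUhat := norm_residual_add_inv_smul_le hμ hμ' h.Y₁_eq hx.norm_Y₁_le hx'.norm_Y₁_le
  have hL := norm_residual_add_inv_smul_le hμ hμ' h.Y₃_eq hx.norm_Y₃_le hx'.norm_Y₃_le
  rw [← norm_neg] at hL
  rw [add_sub_right_comm, show x'.L - μ'⁻¹ • x'.Y₃ - x'.U * x'.Vᵀ =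
    -(x'.U * x'.Vᵀ - x'.L + μ'⁻¹ • x'.Y₃) by abel] at hridge
  linarith

theorem ADMMStep.norm_sub_V_le (h : ADMMStep Ω D lam μ x x') (h' : ADMMStep Ω D lam μ' x' x'')
    (hμ : 0 < μ) (hμ' : 0 < μ') (hx : x.MultipliersLE C) (hx' : x'.MultipliersLE C) :
    ‖x''.V - x'.V‖ ≤ 4 * C * (μ⁻¹ + μ'⁻¹) * (1 + ‖x'.V‖) := by
  have hridge : ‖x''.V - x'.V‖ ≤
      ‖x'.Vhat + μ'⁻¹ • x'.Y₂ - x'.V‖ + ‖(x'.L - μ'⁻¹ • x'.Y₃)ᵀ - x'.V * x''.Uᵀ‖ :=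
    h'.V_eq ▸ opNorm_ridge_sub_le _ x'.V _ x''.U
  have hVhat := norm_residual_add_inv_smul_le hμ hμ' h.Y₂_eq hx.norm_Y₂_le hx'.norm_Y₂_le
  have hL := norm_residual_add_inv_smul_le hμ hμ' h.Y₃_eq hx.norm_Y₃_le hx'.norm_Y₃_le
  have hU := h.norm_sub_U_le h' hμ hμ' hx hx'
  have hUV : ‖(x''.U - x'.U) * x'.Vᵀ‖ ≤ 4 * C * (μ⁻¹ + μ'⁻¹) * ‖x'.V‖ :=
    (l2_opNorm_mul _ _).trans (mul_le_mul hU (opNorm_transpose _).le (norm_nonneg _)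
      ((norm_nonneg _).trans hU))
  have hresidual : (x'.L - μ'⁻¹ • x'.Y₃)ᵀ - x'.V * x''.Uᵀ =
      (-(x'.U * x'.Vᵀ - x'.L + μ'⁻¹ • x'.Y₃ + (x''.U - x'.U) * x'.Vᵀ))ᵀ := by
    simp only [transpose_sub, transpose_neg, transpose_add, transpose_mul, transpose_transpose,
      Matrix.sub_mul]
    abel
  rw [add_sub_right_comm, hresidual, opNorm_transpose, norm_neg] at hridge
  linarith [norm_add_le (x'.U * x'.Vᵀ - x'.L + μ'⁻¹ • x'.Y₃) ((x''.U - x'.U) * x'.Vᵀ)]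

end Step

section Iterates

open scoped Matrix.Norms.L2Operator

variable {m n d : ℕ} {Ω : Set (Fin m × Fin n)} {D : Matrix (Fin m) (Fin n) ℝ} {lam : ℝ}
  {μ : ℕ → ℝ} {x : ℕ → State m n d}

theorem exists_multipliersLE (hlam : 0 < lam) (hμ : ∀ k, 0 < μ k)
    (hx : ∀ k, ADMMStep Ω D lam (μ k) (x k) (x (k + 1)))
    (hY₃ : ∃ C : ℝ, ∀ k, frobNorm (x k).Y₃ ≤ C) : ∃ C, ∀ k, (x (k + 1)).MultipliersLE C := by
  obtain ⟨C, hC⟩ := hY₃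
  exact ⟨max (lam / 2) C, fun k =>
    ⟨((hx k).norm_Y₁_le hlam (hμ k)).trans (le_max_left _ _),
      ((hx k).norm_Y₂_le hlam (hμ k)).trans (le_max_left _ _),
      (opNorm_le_frobNorm _).trans ((hC (k + 1)).trans (le_max_right _ _))⟩⟩

theorem cauchySeq_U_V {C : ℝ} (hμ : ∀ k, 0 < μ k) (hμsum : Summable fun k => (μ k)⁻¹)
    (hx : ∀ k, ADMMStep Ω D lam (μ k) (x k) (x (k + 1)))
    (hC : ∀ k, (x (k + 1)).MultipliersLE C) :
    CauchySeq (fun k => (x k).U) ∧ CauchySeq fun k => (x k).V := by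
  set c : ℕ → ℝ := fun k => 4 * C * ((μ (k + 1))⁻¹ + (μ (k + 2))⁻¹)
  have hc : Summable c :=
    (((summable_nat_add_iff 1).2 hμsum).add ((summable_nat_add_iff 2).2 hμsum)).mul_left (4 * C)
  have hU : ∀ k, ‖(x (k + 3)).U - (x (k + 2)).U‖ ≤ c k := fun k =>
    (hx (k + 1)).norm_sub_U_le (hx (k + 2)) (hμ _) (hμ _) (hC k) (hC (k + 1))
  have hV : ∀ k, ‖(x (k + 3)).V - (x (k + 2)).V‖ ≤ c k * (1 + ‖(x (k + 2)).V‖) := fun k =>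
    (hx (k + 1)).norm_sub_V_le (hx (k + 2)) (hμ _) (hμ _) (hC k) (hC (k + 1))
  constructor
  · refine (cauchySeq_shift 2).1 (cauchySeq_of_dist_le_of_summable c (fun k => ?_) hc)
    rw [dist_comm, dist_eq_norm]
    exact hU k
  · exact (cauchySeq_shift 2).1 (cauchySeq_of_norm_sub_le_mul_one_add_norm
      (fun k => (norm_nonneg _).trans (hU k)) hc hV)

theorem tendsto_L_add_S_sub (hμ : ∀ k, 0 < μ k) (hμsum : Summable fun k => (μ k)⁻¹)
    (hμlim : Tendsto (fun k => μ k ^ (1 / 3 : ℝ) / μ (k + 1)) atTop (𝓝 0))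
    (hx : ∀ k, ADMMStep Ω D lam (μ k) (x k) (x (k + 1))) :
    Tendsto (fun k => (x k).L + (x k).S - D) atTop (𝓝 0) := by
  refine tendsto_pi_nhds.2 fun i => tendsto_pi_nhds.2 fun j => ?_
  have hY₄ : ∀ k, (x (k + 1)).Y₄ i j =
      (x k).Y₄ i j + μ k • ((x (k + 1)).L + (x (k + 1)).S - D) i j := fun k => by
    rw [(hx k).Y₄_eq]
    rfl
  refine tendsto_residual_zero (Y := fun k => (x k).Y₄ i j)
    (R := fun k => ((x k).L + (x k).S - D) i j) (b := fun k => 2 * μ k ^ (1 / 3 : ℝ))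
    hμ hY₄ (fun k => (hx k).abs_Y₄_apply_le (hμ k) i j) ?_ ?_
  · simpa [mul_div_assoc] using (tendsto_rpow_one_third_div_self hμ hμsum).const_mul 2
  · simpa [mul_div_assoc] using hμlim.const_mul 2

theorem tendsto_factor_residuals {C : ℝ} (hμ : ∀ k, 0 < μ k)
    (hμsum : Summable fun k => (μ k)⁻¹) (hx : ∀ k, ADMMStep Ω D lam (μ k) (x k) (x (k + 1)))
    (hC : ∀ k, (x (k + 1)).MultipliersLE C) :
    Tendsto (fun k => (x k).Uhat - (x k).U) atTop (𝓝 0) ∧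
      Tendsto (fun k => (x k).Vhat - (x k).V) atTop (𝓝 0) ∧
      Tendsto (fun k => (x k).U * (x k).Vᵀ - (x k).L) atTop (𝓝 0) := by
  have hself : Tendsto (fun k => C / μ k) atTop (𝓝 0) := by
    simpa [div_eq_mul_inv] using hμsum.tendsto_atTop_zero.const_mul C
  have hsucc : Tendsto (fun k => C / μ (k + 1)) atTop (𝓝 0) :=
    (tendsto_add_atTop_iff_nat 1).2 hself
  exact ⟨tendsto_residual_zero (Y := fun k => (x k).Y₁) hμ (fun k => (hx k).Y₁_eq)
      (fun k => (hC k).norm_Y₁_le) hself hsucc,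
    tendsto_residual_zero (Y := fun k => (x k).Y₂) hμ (fun k => (hx k).Y₂_eq)
      (fun k => (hC k).norm_Y₂_le) hself hsucc,
    tendsto_residual_zero (Y := fun k => (x k).Y₃) hμ (fun k => (hx k).Y₃_eq)
      (fun k => (hC k).norm_Y₃_le) hself hsucc⟩

theorem exists_tendsto_primal (hlam : 0 < lam) (hμ : ∀ k, 0 < μ k)
    (hμsum : Summable fun k => (μ k)⁻¹)
    (hμlim : Tendsto (fun k => μ k ^ (1 / 3 : ℝ) / μ (k + 1)) atTop (𝓝 0))
    (hx : ∀ k, ADMMStep Ω D lam (μ k) (x k) (x (k + 1)))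
    (hY₃ : ∃ C : ℝ, ∀ k, frobNorm (x k).Y₃ ≤ C) :
    ∃ U V, Tendsto (fun k => (x k).primal) atTop (𝓝 (U, V, U, V, U * Vᵀ, D - U * Vᵀ)) := by
  obtain ⟨C, hC⟩ := exists_multipliersLE hlam hμ hx hY₃
  obtain ⟨hUcauchy, hVcauchy⟩ := cauchySeq_U_V hμ hμsum hx hC
  obtain ⟨hUhat, hVhat, hUVL⟩ := tendsto_factor_residuals hμ hμsum hx hC
  obtain ⟨U, hU⟩ := cauchySeq_tendsto_of_complete hUcauchy
  obtain ⟨V, hV⟩ := cauchySeq_tendsto_of_complete hVcauchy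
  have hUV : Tendsto (fun k => (x k).U * (x k).Vᵀ) atTop (𝓝 (U * Vᵀ)) :=
    ((continuous_fst.matrix_mul continuous_snd.matrix_transpose).tendsto (U, V)).comp
      (hU.prodMk_nhds hV)
  have hL : Tendsto (fun k => (x k).L) atTop (𝓝 (U * Vᵀ)) := by simpa using hUV.sub hUVL
  have hS : Tendsto (fun k => (x k).S) atTop (𝓝 (D - U * Vᵀ)) := by
    simpa using ((tendsto_L_add_S_sub hμ hμsum hμlim hx).add_const D).sub hL
  have hU' : Tendsto (fun k => (x k).Uhat) atTop (𝓝 U) := by simpa using hUhat.add hU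
  have hV' : Tendsto (fun k => (x k).Vhat) atTop (𝓝 V) := by simpa using hVhat.add hV
  exact ⟨U, V, hU.prodMk_nhds (hV.prodMk_nhds (hU'.prodMk_nhds (hV'.prodMk_nhds
    (hL.prodMk_nhds hS))))⟩

theorem exists_mapClusterPt_primal_multipliers (hlam : 0 < lam) (hμ : ∀ k, 0 < μ k)
    (hx : ∀ k, ADMMStep Ω D lam (μ k) (x k) (x (k + 1))) {p}
    (hlim : Tendsto (fun k => (x k).primal) atTop (𝓝 p)) :
    ∃ Y₁ Y₂, MapClusterPt (p, Y₁, Y₂) atTop fun k => ((x k).primal, (x k).Y₁, (x k).Y₂) := by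
  obtain ⟨⟨Y₁, Y₂⟩, -, φ, hφ, hY⟩ := tendsto_subseq_of_bounded
    (Metric.isBounded_closedBall (x := 0) (r := lam / 2))
    (x := fun k => ((x (k + 1)).Y₁, (x (k + 1)).Y₂)) fun k => mem_closedBall_zero_iff.2 <|
      max_le ((hx k).norm_Y₁_le hlam (hμ k)) ((hx k).norm_Y₂_le hlam (hμ k))
  have hφ₁ : Tendsto (fun k => φ k + 1) atTop atTop :=
    tendsto_add_atTop_nat 1 |>.comp hφ.tendsto_atTop
  exact ⟨Y₁, Y₂, .of_comp hφ₁ ((hlim.comp hφ₁).prodMk_nhds hY).mapClusterPt⟩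

end Iterates

section ClusterPoints

variable {m n d : ℕ} {Ω : Set (Fin m × Fin n)} {D : Matrix (Fin m) (Fin n) ℝ} {lam : ℝ}
  {μ : ℕ → ℝ} {x : ℕ → State m n d}

theorem mem_of_mapClusterPt_of_forall_succ {E : Type*} [TopologicalSpace E] {s : Set E} {u : ℕ → E}
    {a : E} (hs : IsClosed s) (hu : ∀ k, u (k + 1) ∈ s) (ha : MapClusterPt a atTop u) : a ∈ s := by
  refine hs.mem_of_mapClusterPt ha ?_
  filter_upwards [eventually_ge_atTop 1] with k hk
  obtain ⟨k, rfl⟩ := Nat.exists_eq_add_of_le' hk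
  exact hu k

theorem isNuclearMultiplier_of_mapClusterPt {p q : ℕ} {c : ℝ} (hc : c ≠ 0)
    {X Y : ℕ → Matrix (Fin p) (Fin q) ℝ} (hXY : ∀ k, IsNuclearMultiplier c (X (k + 1)) (Y (k + 1)))
    {X₀ Y₀ : Matrix (Fin p) (Fin q) ℝ}
    (hcl : MapClusterPt (X₀, Y₀) atTop fun k => (X k, Y k)) : IsNuclearMultiplier c X₀ Y₀ := by
  have hmem := mem_of_mapClusterPt_of_forall_succ (u := fun k => (X k, Y k))
    (isClosed_setOf_isNuclearMultiplier hc) hXY hcl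
  exact hmem

theorem isPenaltyMultiplier_of_mapClusterPt (hμ : ∀ k, 0 < μ k)
    (hx : ∀ k, ADMMStep Ω D lam (μ k) (x k) (x (k + 1))) {S Y₄ : Matrix (Fin m) (Fin n) ℝ}
    (hcl : MapClusterPt (S, Y₄) atTop fun k => ((x k).S, (x k).Y₄)) :
    IsPenaltyMultiplier Ω S Y₄ := by
  have hmem := mem_of_mapClusterPt_of_forall_succ (isClosed_setOf_isPenaltyMultiplier Ω)
    (fun k => (hx k).isPenaltyMultiplier_Y₄ (hμ k)) hcl
  exact hmem

theorem isKKT_of_mapClusterPt (hlam : 0 < lam) (hμ : ∀ k, 0 < μ k)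
    (hx : ∀ k, ADMMStep Ω D lam (μ k) (x k) (x (k + 1)))
    {U Y₁ : Matrix (Fin m) (Fin d) ℝ} {V Y₂ : Matrix (Fin n) (Fin d) ℝ}
    {Y₄ : Matrix (Fin m) (Fin n) ℝ}
    (hcl : MapClusterPt ((U, V, U, V, U * Vᵀ, D - U * Vᵀ), Y₁, Y₂) atTop
      fun k => ((x k).primal, (x k).Y₁, (x k).Y₂))
    (hY₄ : IsPenaltyMultiplier Ω (D - U * Vᵀ) Y₄) :
    IsKKT Ω D lam U V U V (U * Vᵀ) (D - U * Vᵀ) Y₁ Y₂ Y₄ := by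
  have hUhat : IsNuclearMultiplier (lam / 2) U Y₁ :=
    isNuclearMultiplier_of_mapClusterPt (X := fun k => (x k).Uhat) (Y := fun k => (x k).Y₁)
      (half_pos hlam).ne' (fun k => (hx k).isNuclearMultiplier_Y₁ hlam (hμ k))
      (hcl.continuousAt_comp (f := fun q => (q.1.2.2.1, q.2.1)) (by fun_prop))
  have hVhat : IsNuclearMultiplier (lam / 2) V Y₂ :=
    isNuclearMultiplier_of_mapClusterPt (X := fun k => (x k).Vhat) (Y := fun k => (x k).Y₂)
      (half_pos hlam).ne' (fun k => (hx k).isNuclearMultiplier_Y₂ hlam (hμ k))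
      (hcl.continuousAt_comp (f := fun q => (q.1.2.2.2.1, q.2.2)) (by fun_prop))
  exact ⟨hUhat, hVhat, ⟨-Y₄, hY₄.neg_mem_limitingSubdiff, by rw [hY₄.proj_eq, neg_add_cancel]⟩,
    hY₄.proj_compl_eq_zero, rfl, rfl, rfl, add_sub_cancel _ _⟩

end ClusterPoints

end HalfRPCA

theorem theorem3_general {m n d : ℕ} (Ω : Set (Fin m × Fin n)) (D : Matrix (Fin m) (Fin n) ℝ)
    (lam : ℝ) (hlam : 0 < lam) (μ : ℕ → ℝ) (hμpos : ∀ k, 0 < μ k)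
    (hμsum : Summable fun k => (μ k)⁻¹)
    (hμlim : Tendsto (fun k => μ k ^ (1 / 3 : ℝ) / μ (k + 1)) atTop (𝓝 0))
    (x : ℕ → HalfRPCA.State m n d)
    (hx : ∀ k, HalfRPCA.ADMMStep Ω D lam (μ k) (x k) (x (k + 1)))
    (hY₃ : ∃ C : ℝ, ∀ k, HalfRPCA.frobNorm (x k).Y₃ ≤ C) :
    (CauchySeq (fun k => ((x k).U, (x k).V)) ∧
      CauchySeq (fun k => ((x k).Uhat, (x k).Vhat)) ∧
      CauchySeq (fun k => (x k).L) ∧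
      CauchySeq (fun k => (x k).S)) ∧
    (∀ (U : Matrix (Fin m) (Fin d) ℝ) (V : Matrix (Fin n) (Fin d) ℝ)
        (Uhat : Matrix (Fin m) (Fin d) ℝ) (Vhat : Matrix (Fin n) (Fin d) ℝ)
        (L S : Matrix (Fin m) (Fin n) ℝ),
      MapClusterPt (U, V, Uhat, Vhat, L, S) atTop (fun k => (x k).primal) →
      (∃ (Y₁ : Matrix (Fin m) (Fin d) ℝ) (Y₂ : Matrix (Fin n) (Fin d) ℝ)
          (Y₄ : Matrix (Fin m) (Fin n) ℝ),
        MapClusterPt ((U, V, Uhat, Vhat, L, S), Y₁, Y₂) atTop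
          (fun k => ((x k).primal, (x k).Y₁, (x k).Y₂)) ∧
        HalfRPCA.IsKKT Ω D lam U V Uhat Vhat L S Y₁ Y₂ Y₄) ∧
      (∀ (Y₁ : Matrix (Fin m) (Fin d) ℝ) (Y₂ : Matrix (Fin n) (Fin d) ℝ)
          (Y₄ : Matrix (Fin m) (Fin n) ℝ),
        MapClusterPt ((U, V, Uhat, Vhat, L, S), Y₁, Y₂, Y₄) atTop
          (fun k => ((x k).primal, (x k).Y₁, (x k).Y₂, (x k).Y₄)) →
        HalfRPCA.IsKKT Ω D lam U V Uhat Vhat L S Y₁ Y₂ Y₄)) := by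
  obtain ⟨U₀, V₀, hlim⟩ := HalfRPCA.exists_tendsto_primal hlam hμpos hμsum hμlim hx hY₃
  have hcauchy {E : Type} [UniformSpace E] (f : _ → E) (hf : Continuous f) :
      CauchySeq fun k => f (x k).primal := ((hf.tendsto _).comp hlim).cauchySeq
  refine ⟨⟨hcauchy (fun p => (p.1, p.2.1)) (by fun_prop),
    hcauchy (fun p => (p.2.2.1, p.2.2.2.1)) (by fun_prop),
    hcauchy (fun p => p.2.2.2.2.1) (by fun_prop), hcauchy (fun p => p.2.2.2.2.2) (by fun_prop)⟩,
    fun U V Uhat Vhat L S hcl => ?_⟩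
  have heq := eq_of_nhds_neBot (ClusterPt.mono hcl hlim)
  simp only [Prod.mk.injEq] at heq
  obtain ⟨rfl, rfl, rfl, rfl, rfl, rfl⟩ := heq
  refine ⟨?_, fun Y₁ Y₂ Y₄ hcl => ?_⟩
  · obtain ⟨Y₁, Y₂, hY⟩ := HalfRPCA.exists_mapClusterPt_primal_multipliers hlam hμpos hx hlim
    obtain ⟨Y₄, hY₄⟩ := HalfRPCA.exists_isPenaltyMultiplier Ω (D - Uhat * Vhatᵀ)
    exact ⟨Y₁, Y₂, Y₄, hY, HalfRPCA.isKKT_of_mapClusterPt hlam hμpos hx hY hY₄⟩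
  · exact HalfRPCA.isKKT_of_mapClusterPt hlam hμpos hx
      (hcl.continuousAt_comp (f := fun q => (q.1, q.2.1, q.2.2.1)) (by fun_prop))
      (HalfRPCA.isPenaltyMultiplier_of_mapClusterPt hμpos hx
        (hcl.continuousAt_comp (f := fun q => (q.1.2.2.2.2.2, q.2.2.2)) (by fun_prop)))

theorem theorem3 {m n d : ℕ} (Ω : Set (Fin m × Fin n)) (D : Matrix (Fin m) (Fin n) ℝ)
    (lam : ℝ) (hlam : 0 < lam)
    (μ : ℕ → ℝ) (hμpos : ∀ k, 0 < μ k) (hμmono : Monotone μ)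
    (hμsum : Summable fun k => μ (k + 1) / μ k ^ (4 / 3 : ℝ))
    (x : ℕ → HalfRPCA.State m n d)
    (hx : ∀ k, HalfRPCA.ADMMStep Ω D lam (μ k) (x k) (x (k + 1)))
    (hY₃ : ∃ C : ℝ, ∀ k, HalfRPCA.frobNorm (x k).Y₃ ≤ C) :
    (CauchySeq (fun k => ((x k).U, (x k).V)) ∧
      CauchySeq (fun k => ((x k).Uhat, (x k).Vhat)) ∧
      CauchySeq (fun k => (x k).L) ∧
      CauchySeq (fun k => (x k).S)) ∧
    (∀ (U : Matrix (Fin m) (Fin d) ℝ) (V : Matrix (Fin n) (Fin d) ℝ)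
        (Uhat : Matrix (Fin m) (Fin d) ℝ) (Vhat : Matrix (Fin n) (Fin d) ℝ)
        (L S : Matrix (Fin m) (Fin n) ℝ),
      MapClusterPt (U, V, Uhat, Vhat, L, S) atTop (fun k => (x k).primal) →
      (∃ (Y₁ : Matrix (Fin m) (Fin d) ℝ) (Y₂ : Matrix (Fin n) (Fin d) ℝ)
          (Y₄ : Matrix (Fin m) (Fin n) ℝ),
        MapClusterPt ((U, V, Uhat, Vhat, L, S), Y₁, Y₂) atTop
          (fun k => ((x k).primal, (x k).Y₁, (x k).Y₂)) ∧
        HalfRPCA.IsKKT Ω D lam U V Uhat Vhat L S Y₁ Y₂ Y₄) ∧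
      (∀ (Y₁ : Matrix (Fin m) (Fin d) ℝ) (Y₂ : Matrix (Fin n) (Fin d) ℝ)
          (Y₄ : Matrix (Fin m) (Fin n) ℝ),
        MapClusterPt ((U, V, Uhat, Vhat, L, S), Y₁, Y₂, Y₄) atTop
          (fun k => ((x k).primal, (x k).Y₁, (x k).Y₂, (x k).Y₄)) →
        HalfRPCA.IsKKT Ω D lam U V Uhat Vhat L S Y₁ Y₂ Y₄)) := by
  have hμinv := HalfRPCA.summable_inv_of_summable_div_rpow hμpos hμmono hμsum
  exact theorem3_general Ω D lam hlam μ hμpos hμinv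
    (HalfRPCA.tendsto_rpow_one_third_div_succ hμpos hμmono hμinv) x hx hY₃
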